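/- For an entire function $F$ put $F^*(z)=\overline{F(\bar z)}$. For $\delta\ge 0$ we say that an entire function $F$ has exponential type $\delta$ if for every $\varepsilon>0$ there is $C_\varepsilon>0$ with $|F(z)|\le C_\varepsilon e^{(\delta+\varepsilon)|z|}$ for all $z\in\mathbb{C}$. A function $F$ analytic in the upper half plane $\mathbb{C}^+$ has bounded type if $F=P/Q$ there with $P,Q$ bounded and analytic in $\mathbb{C}^+$ and $Q\not\equiv 0$; its mean type is $v(F)=\limsup_{y\to\infty}y^{-1}\log|F(iy)|$ (with $\log 0=-\infty$). An entire function $E$ is a Hermite–Biehler function if $|E(z)|>|E^*(z)|$ for all $z$ with $\Im z>0$. For such $E$, let $\mathcal{H}(E)$ be the space of entire functions $F$ with $\int_{-\infty}^\infty |F(x)|^2|E(x)|^{-2}\,dx<\infty$ such that $F/E$ and $F^*/E$ have bounded type and nonpositive mean type in $\mathbb{C}^+$, with the scalar product $\langle F,G\rangle_E=\int_{-\infty}^\infty F(x)G^*(x)|E(x)|^{-2}\,dx$. **Theorem.** Let $a>0$, and let $E_a$ be the function $$E_a(z)=\Big(\frac{2}{\sinh(2\pi a)}\Big)^{1/2}\,\frac{\sin\pi(z+ia)}{z+ia},$$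 with the removable singularity at $z=-ia$ removed. Then $E_a$ is a Hermite–Biehler function, and * (I) $E_a$ has bounded type in $\mathbb{C}^+$ with mean type $\pi$; * (II) $E_a$ has no real zeros; * (III) the function $z\mapsto E_a(iz)$ is real entire, i.e. entire and real-valued on $\mathbb{R}$; * (IV) the function $B_a=\frac{i}{2}(E_a-E_a^*)$ does not belong to $\mathcal{H}(E_a)$. Moreover, the space $\mathcal{A}_2(\pi,\mu_a)$ of entire functions $F$ of exponential type $\pi$ with $\int_{-\infty}^\infty|F(x)|^2(x^2+a^2)\,dx<\infty$ is isometrically equal to $\mathcal{H}(E_a)$: the two spaces consist of the same functions, and for all $F,G$ in them $$\int_{-\infty}^\infty F(x)G^*(x)\,(x^2+a^2)\,dx=\int_{-\infty}^\infty F(x)G^*(x)\,|E_a(x)|^{-2}\,dx,$$ so that in particular $$\int_{-\infty}^\infty |F(x)|^2(x^2+a^2)\,dx=\int_{-\infty}^\infty \Big|\frac{F(x)}{E_a(x)}\Big|^2dx .$$ -/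

import Mathlib

namespace DeBranges

open Complex MeasureTheory Filter Topology
open scoped ENNReal ComplexConjugate

/-! ### Entire functions and exponential type -/

/-- `F` is an entire function of exponential type (at most) `δ`: for every `ε > 0` there is
`C > 0` with `|F z| ≤ C exp ((δ + ε) |z|)` on all of `ℂ`. -/
def IsExpType (δ : ℝ) (F : ℂ → ℂ) : Prop :=
  Differentiable ℂ F ∧
    ∀ ε : ℝ, 0 < ε → ∃ C : ℝ, 0 < C ∧ ∀ z : ℂ, ‖F z‖ ≤ C * Real.exp ((δ + ε) * ‖z‖)

/-- The conjugate function `F^*(z) = conj (F (conj z))`. -/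
def starFn (F : ℂ → ℂ) : ℂ → ℂ := fun z => conj (F (conj z))

/-- `F` is real entire: entire, with real values on the real axis. -/
def IsRealEntire (F : ℂ → ℂ) : Prop :=
  Differentiable ℂ F ∧ ∀ x : ℝ, (F (x : ℂ)).im = 0

/-- `E` is a Hermite-Biehler function: entire with `|E z| > |E^* z|` on the upper half plane. -/
def IsHermiteBiehler (E : ℂ → ℂ) : Prop :=
  Differentiable ℂ E ∧ ∀ z : ℂ, 0 < z.im → ‖starFn E z‖ < ‖E z‖

/-! ### Bounded type and mean type in the upper half plane -/

/-- The open upper half plane, as a set. -/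
def upperHP : Set ℂ := {z : ℂ | 0 < z.im}

/-- `F` is analytic and of bounded type in the upper half plane: `F = P / Q` there, with `P`, `Q`
bounded and analytic and `Q` not identically zero. -/
def IsBoundedType (F : ℂ → ℂ) : Prop :=
  DifferentiableOn ℂ F upperHP ∧
    ∃ P Q : ℂ → ℂ, DifferentiableOn ℂ P upperHP ∧ DifferentiableOn ℂ Q upperHP ∧
      (∃ M : ℝ, ∀ z ∈ upperHP, ‖P z‖ ≤ M) ∧ (∃ M : ℝ, ∀ z ∈ upperHP, ‖Q z‖ ≤ M) ∧
      (∃ z ∈ upperHP, Q z ≠ 0) ∧ ∀ z ∈ upperHP, F z * Q z = P z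

/-- The mean type `limsup_{y → ∞} y⁻¹ log |F (i y)|`, as an extended real number, with
`log 0 = -∞`. -/
noncomputable def meanType (F : ℂ → ℂ) : EReal :=
  limsup (fun y : ℝ => ((y⁻¹ : ℝ) : EReal) * ENNReal.log ‖F (I * (y : ℂ))‖ₑ) atTop

/-! ### Facts needed to see that the spaces below are closed under the vector space operations -/

lemma IsExpType.zero (δ : ℝ) : IsExpType δ 0 :=
  ⟨differentiable_const 0, fun _ _ => ⟨1, one_pos, fun z => by simp; positivity⟩⟩

lemma IsExpType.add {δ : ℝ} {F G : ℂ → ℂ} (hF : IsExpType δ F) (hG : IsExpType δ G) :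
    IsExpType δ (F + G) := by
  refine ⟨hF.1.add hG.1, fun ε hε => ?_⟩
  obtain ⟨C, hC, h1⟩ := hF.2 ε hε
  obtain ⟨D, hD, h2⟩ := hG.2 ε hε
  refine ⟨C + D, by positivity, fun z => ?_⟩
  rw [add_mul]
  exact (norm_add_le _ _).trans (add_le_add (h1 z) (h2 z))

lemma IsExpType.smul {δ : ℝ} {F : ℂ → ℂ} (c : ℂ) (hF : IsExpType δ F) :
    IsExpType δ (c • F) := by
  refine ⟨hF.1.const_smul c, fun ε hε => ?_⟩
  obtain ⟨C, hC, h1⟩ := hF.2 ε hε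
  refine ⟨(‖c‖ + 1) * C, by positivity, fun z => ?_⟩
  rw [Pi.smul_apply, smul_eq_mul, norm_mul, mul_assoc]
  exact mul_le_mul (by linarith) (h1 z) (norm_nonneg _) (by positivity)

lemma IsBoundedType.zero : IsBoundedType 0 :=
  ⟨differentiableOn_const 0, 0, 1, differentiableOn_const 0, differentiableOn_const 1,
    ⟨0, by simp⟩, ⟨1, by simp⟩, ⟨I, by simp [upperHP], by simp⟩, by simp⟩

lemma IsBoundedType.smul {F : ℂ → ℂ} (c : ℂ) (hF : IsBoundedType F) :
    IsBoundedType (c • F) := by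
  obtain ⟨hd, P, Q, hP, hQ, ⟨M, hM⟩, hN, hne, h⟩ := hF
  refine ⟨hd.const_smul c, c • P, Q, hP.const_smul c, hQ, ⟨‖c‖ * M, fun z hz => ?_⟩, hN, hne,
    fun z hz => ?_⟩
  · rw [Pi.smul_apply, smul_eq_mul, norm_mul]
    exact mul_le_mul_of_nonneg_left (hM z hz) (norm_nonneg _)
  · simp only [Pi.smul_apply, smul_eq_mul, mul_assoc, h z hz]

lemma isOpen_upperHP : IsOpen upperHP := isOpen_lt continuous_const Complex.continuous_im

lemma isPreconnected_upperHP : IsPreconnected upperHP :=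
  (convex_halfSpace_im_gt 0).isPreconnected

lemma exists_mul_ne_zero {P Q : ℂ → ℂ} (hP : DifferentiableOn ℂ P upperHP)
    (hQ : DifferentiableOn ℂ Q upperHP) (h1 : ∃ z ∈ upperHP, P z ≠ 0)
    (h2 : ∃ z ∈ upperHP, Q z ≠ 0) : ∃ z ∈ upperHP, P z * Q z ≠ 0 := by
  by_contra! h
  rcases (hP.analyticOnNhd isOpen_upperHP).eq_zero_or_eq_zero_of_mul_eq_zero
    (hQ.analyticOnNhd isOpen_upperHP) h isPreconnected_upperHP with h0 | h0
  · obtain ⟨z, hz, hne⟩ := h1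
    exact hne (h0 z hz)
  · obtain ⟨z, hz, hne⟩ := h2
    exact hne (h0 z hz)

lemma IsBoundedType.add {F G : ℂ → ℂ} (hF : IsBoundedType F) (hG : IsBoundedType G) :
    IsBoundedType (F + G) := by
  obtain ⟨hd, P, Q, hP, hQ, ⟨M, hM⟩, ⟨N, hN⟩, hne, h⟩ := hF
  obtain ⟨hd', P', Q', hP', hQ', ⟨M', hM'⟩, ⟨N', hN'⟩, hne', h'⟩ := hG
  have key : ∀ {a b : ℂ} {A B : ℝ}, ‖a‖ ≤ A → ‖b‖ ≤ B → ‖a * b‖ ≤ A * B := by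
    intro a b A B ha hb
    rw [norm_mul]
    exact mul_le_mul ha hb (norm_nonneg _) ((norm_nonneg _).trans ha)
  refine ⟨hd.add hd', fun z => P z * Q' z + P' z * Q z, fun z => Q z * Q' z,
    (hP.mul hQ').add (hP'.mul hQ), hQ.mul hQ', ⟨M * N' + M' * N, fun z hz => ?_⟩,
    ⟨N * N', fun z hz => key (hN z hz) (hN' z hz)⟩, exists_mul_ne_zero hQ hQ' hne hne',
    fun z hz => ?_⟩
  · exact (norm_add_le _ _).trans
      (add_le_add (key (hM z hz) (hN' z hz)) (key (hM' z hz) (hN z hz)))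
  · simp only [Pi.add_apply, ← h z hz, ← h' z hz]
    ring

lemma inv_mul_log_le_iff {y ε : ℝ} (hy : 0 < y) (w : ℂ) :
    ((y⁻¹ : ℝ) : EReal) * ENNReal.log ‖w‖ₑ ≤ (ε : EReal) ↔ ‖w‖ ≤ Real.exp (ε * y) := by
  by_cases hw : w = 0
  · subst hw
    simp [EReal.coe_mul_bot_of_pos (inv_pos.2 hy), (Real.exp_pos _).le]
  · have hw' : 0 < ‖w‖ := norm_pos_iff.2 hw
    rw [← ofReal_norm, ENNReal.log_ofReal_of_pos hw', ← EReal.coe_mul,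
      EReal.coe_le_coe_iff, inv_mul_le_iff₀ hy, ← Real.log_le_iff_le_exp hw', mul_comm]

/-- Nonpositive mean type means growth slower than every exponential along the imaginary axis. -/
lemma meanType_nonpos_iff (F : ℂ → ℂ) :
    meanType F ≤ 0 ↔
      ∀ ε : ℝ, 0 < ε → ∀ᶠ y : ℝ in atTop, ‖F (I * (y : ℂ))‖ ≤ Real.exp (ε * y) := by
  constructor
  · intro h ε hε
    have h1 : meanType F < (ε : EReal) := h.trans_lt (by exact_mod_cast hε)
    filter_upwards [eventually_lt_of_limsup_lt h1, eventually_gt_atTop 0] with y hy hy0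
    exact (inv_mul_log_le_iff hy0 _).1 hy.le
  · intro h
    refine EReal.le_of_forall_lt_iff_le.1 fun ε hε => ?_
    have hε' : 0 < ε := by exact_mod_cast hε
    refine limsup_le_of_le (by isBoundedDefault) ?_
    filter_upwards [h ε hε', eventually_gt_atTop 0] with y hy hy0
    exact (inv_mul_log_le_iff hy0 _).2 hy

lemma meanType_zero_nonpos : meanType 0 ≤ 0 :=
  (meanType_nonpos_iff 0).2 fun ε _ => Eventually.of_forall fun y => by
    simp [(Real.exp_pos _).le]

lemma eventually_const_mul_exp_le (C : ℝ) {ε : ℝ} (hε : 0 < ε) :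
    ∀ᶠ y : ℝ in atTop, C * Real.exp (ε / 2 * y) ≤ Real.exp (ε * y) := by
  have h : Tendsto (fun y : ℝ => Real.exp (ε / 2 * y)) atTop atTop :=
    Real.tendsto_exp_atTop.comp (tendsto_id.const_mul_atTop (half_pos hε))
  filter_upwards [h.eventually_ge_atTop C] with y hy
  calc C * Real.exp (ε / 2 * y) ≤ Real.exp (ε / 2 * y) * Real.exp (ε / 2 * y) :=
        mul_le_mul_of_nonneg_right hy (Real.exp_pos _).le
    _ = Real.exp (ε * y) := by rw [← Real.exp_add]; congr 1; ring

lemma meanType_add_nonpos {F G : ℂ → ℂ} (hF : meanType F ≤ 0) (hG : meanType G ≤ 0) :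
    meanType (F + G) ≤ 0 := by
  rw [meanType_nonpos_iff] at *
  intro ε hε
  filter_upwards [hF _ (half_pos hε), hG _ (half_pos hε), eventually_const_mul_exp_le 2 hε]
    with y h1 h2 h3
  refine (norm_add_le _ _).trans ?_
  linarith

lemma meanType_smul_nonpos {F : ℂ → ℂ} (c : ℂ) (hF : meanType F ≤ 0) :
    meanType (c • F) ≤ 0 := by
  rw [meanType_nonpos_iff] at *
  intro ε hε
  filter_upwards [hF _ (half_pos hε), eventually_const_mul_exp_le ‖c‖ hε] with y h1 h3
  rw [Pi.smul_apply, smul_eq_mul, norm_mul]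
  exact (mul_le_mul_of_nonneg_left h1 (norm_nonneg _)).trans h3

/-! ### The spaces -/

/-- The space of entire functions of exponential type `δ` whose restriction to the real line is
`p`-integrable with respect to `μ`. -/
def expTypeSpace (p : ℝ≥0∞) (δ : ℝ) (μ : Measure ℝ) : Submodule ℂ (ℂ → ℂ) where
  carrier := {F | IsExpType δ F ∧ MemLp (fun x : ℝ => F (x : ℂ)) p μ}
  zero_mem' := ⟨IsExpType.zero δ, MemLp.zero⟩
  add_mem' := fun hF hG => ⟨hF.1.add hG.1, hF.2.add hG.2⟩
  smul_mem' := fun c _ hF => ⟨hF.1.smul c, hF.2.const_smul c⟩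

/-- The measure `|E x|⁻² dx` on the real line. -/
noncomputable def deBrangesMeasure (E : ℂ → ℂ) : Measure ℝ :=
  volume.withDensity fun x : ℝ => (‖E (x : ℂ)‖ₑ ^ 2)⁻¹

/-- The de Branges space `H(E)`: entire functions `F`, square-integrable with respect to
`|E x|⁻² dx`, such that `F / E` and `F^* / E` are of bounded type and of nonpositive mean type
in the upper half plane. -/
noncomputable def deBrangesSpace (E : ℂ → ℂ) : Submodule ℂ (ℂ → ℂ) where
  carrier := {F | Differentiable ℂ F ∧ MemLp (fun x : ℝ => F (x : ℂ)) 2 (deBrangesMeasure E) ∧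
    (IsBoundedType (F / E) ∧ meanType (F / E) ≤ 0) ∧
    (IsBoundedType (starFn F / E) ∧ meanType (starFn F / E) ≤ 0)}
  zero_mem' := by
    have h : starFn 0 = 0 := by ext; simp [starFn]
    have h0 : (0 : ℂ → ℂ) / E = 0 := by ext; simp
    refine ⟨differentiable_const 0, MemLp.zero, ?_, ?_⟩
    · rw [h0]
      exact ⟨IsBoundedType.zero, meanType_zero_nonpos⟩
    · rw [h, h0]
      exact ⟨IsBoundedType.zero, meanType_zero_nonpos⟩
  add_mem' := by
    rintro F G ⟨hF, hF2, hF3, hF4⟩ ⟨hG, hG2, hG3, hG4⟩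
    have h : starFn (F + G) = starFn F + starFn G := by ext; simp [starFn]
    have h0 : ∀ P Q : ℂ → ℂ, (P + Q) / E = P / E + Q / E := fun P Q => by ext; simp [add_div]
    refine ⟨hF.add hG, hF2.add hG2, ?_, ?_⟩
    · rw [h0]
      exact ⟨hF3.1.add hG3.1, meanType_add_nonpos hF3.2 hG3.2⟩
    · rw [h, h0]
      exact ⟨hF4.1.add hG4.1, meanType_add_nonpos hF4.2 hG4.2⟩
  smul_mem' := by
    rintro c F ⟨hF, hF2, hF3, hF4⟩
    have h : starFn (c • F) = conj c • starFn F := by ext; simp [starFn]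
    have h0 : ∀ (d : ℂ) (P : ℂ → ℂ), (d • P) / E = d • (P / E) := fun d P => by
      ext; simp [mul_div_assoc]
    refine ⟨hF.const_smul c, hF2.const_smul c, ?_, ?_⟩
    · rw [h0]
      exact ⟨hF3.1.smul c, meanType_smul_nonpos c hF3.2⟩
    · rw [h, h0]
      exact ⟨hF4.1.smul _, meanType_smul_nonpos _ hF4.2⟩

/-- The scalar product `⟨F, G⟩ = ∫ F(x) G^*(x) dμ(x)` over the real line. -/
noncomputable def scalarProd (μ : Measure ℝ) (F G : ℂ → ℂ) : ℂ :=
  ∫ x : ℝ, F (x : ℂ) * starFn G (x : ℂ) ∂μ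

/-- The companion function `B = (i/2) (E - E^*)`. -/
noncomputable def companionB (E : ℂ → ℂ) : ℂ → ℂ := fun z => (I / 2) * (E z - starFn E z)

/-- The four standing conditions (I)-(IV) on a Hermite-Biehler function `E`, with mean type `τ`. -/
structure StandingConditions (E : ℂ → ℂ) (τ : ℝ) : Prop where
  boundedType : IsBoundedType E
  meanType_eq : meanType E = (τ : EReal)
  ne_zero_real : ∀ x : ℝ, E (x : ℂ) ≠ 0
  realEntire : IsRealEntire fun z => E (I * z)
  companionB_notMem : companionB E ∉ deBrangesSpace E

/-! ### The function `E_a` and the measure `(x² + a²) dx` -/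

/-- `E_a(z) = (2 / sinh 2πa)^{1/2} sin (π (z + i a)) / (z + i a)`, with the removable singularity
at `z = - i a` removed. -/
noncomputable def Ea (a : ℝ) : ℂ → ℂ := fun z =>
  (Real.sqrt (2 / Real.sinh (2 * Real.pi * a)) : ℂ) *
    (if z + I * a = 0 then (Real.pi : ℂ)
      else Complex.sin (Real.pi * (z + I * a)) / (z + I * a))

/-- The measure `(x² + a²) dx` on the real line. -/
noncomputable def muA (a : ℝ) : Measure ℝ :=
  volume.withDensity fun x : ℝ => ENNReal.ofReal (x ^ 2 + a ^ 2)

end DeBranges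

namespace DeBranges

open Complex MeasureTheory Filter Topology
open scoped ENNReal ComplexConjugate

/-! On the real line `|E_a|⁻² = (x² + a²) P(x)`, where `P` is the Poisson kernel of period 1. It
lies between two positive constants, so the two square-integrability conditions agree.

Equality of the scalar products rests on `P(x) = 1 + p(x) + p(-x)`, with `p` analytic and `O(exp
(-2π Im z))` in the upper half plane (`poissonPi_eq`). For `F`, `G` in the space, `H = (z² + a²) F
G^*` is integrable on the line and `O(exp (2π |Im z|))`. Hence `H p` is bounded in the upper half
plane and its integral over the line is zero (`integral_eq_zero_of_bounded_upperHP`). The reflected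
term vanishes likewise, and only the constant 1 is seen.

Equality of the spaces needs a sharp bound. The quadratic weight makes `F` integrable on the line,
so its primitive is bounded there; Phragmén–Lindelöf bounds the primitive by a multiple of `exp (π
|Im z|)`, and Cauchy's estimate passes this on to `F` (`exists_norm_le_exp_abs_im`). The bounded
type and mean type conditions follow. Conversely, membership in `H(E_a)` gives no explicit growth
bound away from the imaginary axis; finite exponential type comes from Krein's theorem
(`exists_norm_le_exp_of_isBoundedType`), proved with circle means of `log⁺ |F|` in a disc
coordinate.

The Hermite–Biehler inequality says that `|sin πw / w|` increases with `|Im w|` on vertical lines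
(`norm_sincPi_lt`). Condition (IV) holds because the weighted square of `B_a` behaves like a
multiple of `cos² πx`, which is not integrable. -/

/-! ### Phragmén–Lindelöf bounds for functions of finite exponential type -/

/-- A function of finite exponential type, bounded by `M` on the real axis and of type `s` along
the positive imaginary axis, is bounded by `M exp (s Im z)` in the upper half plane. -/
lemma norm_le_exp_im_of_bounded_real {Φ : ℂ → ℂ} {s M : ℝ} (hΦ : Differentiable ℂ Φ)
    (hgrowth : ∃ B C : ℝ, ∀ z, ‖Φ z‖ ≤ C * Real.exp (B * ‖z‖))
    (hreal : ∀ x : ℝ, ‖Φ x‖ ≤ M)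
    (him : ∀ ε : ℝ, 0 < ε → ∃ K : ℝ, ∀ y : ℝ, 0 ≤ y → ‖Φ (I * y)‖ ≤ K * Real.exp ((s + ε) * y))
    {z : ℂ} (hz : 0 ≤ z.im) : ‖Φ z‖ ≤ M * Real.exp (s * z.im) := by
  have key : ∀ ε : ℝ, 0 < ε → ‖Φ z‖ ≤ M * Real.exp ((s + ε) * z.im) := by
    intro ε hε
    obtain ⟨K, hK⟩ := him ε hε
    obtain ⟨B, C, hBC⟩ := hgrowth
    -- Rotation by `I` turns the upper half plane into the right one. The exponential factor makes
    -- the function bounded on the positive real axis and has modulus one on the imaginary axis. The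
    -- resulting bound does not involve `K`, so `ε → 0` is harmless.
    have hf : Differentiable ℂ fun w : ℂ => Φ (I * w) * cexp (-((s + ε : ℝ) : ℂ) * w) := by
      fun_prop
    have hn : ∀ w : ℂ, ‖Φ (I * w) * cexp (-((s + ε : ℝ) : ℂ) * w)‖ =
        ‖Φ (I * w)‖ * Real.exp (-(s + ε) * w.re) := by
      intro w
      rw [norm_mul, Complex.norm_exp]
      congr 2
      rw [← ofReal_neg, re_ofReal_mul]
    have h := PhragmenLindelof.right_half_plane_of_bounded_on_real (C := M) (z := -I * z)
      (f := fun w : ℂ => Φ (I * w) * cexp (-((s + ε : ℝ) : ℂ) * w)) hf.diffContOnCl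
      ⟨1, by norm_num, B + |s + ε|, ?_⟩ ?_ ?_ (by simpa using hz)
    · rw [hn, ← mul_assoc] at h
      simp only [mul_neg, I_mul_I, neg_neg, one_mul, neg_mul, neg_re, mul_re, I_re, zero_mul, I_im,
        zero_sub] at h
      have e1 : Real.exp ((s + ε) * z.im) * Real.exp (-((s + ε) * z.im)) = 1 := by
        rw [← Real.exp_add]; simp
      calc ‖Φ z‖ = ‖Φ z‖ * Real.exp (-((s + ε) * z.im)) * Real.exp ((s + ε) * z.im) := by
            rw [mul_assoc, mul_comm (Real.exp _), e1, mul_one]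
        _ ≤ _ := mul_le_mul_of_nonneg_right h (Real.exp_pos _).le
    · refine Asymptotics.IsBigO.of_bound |C| (Eventually.of_forall fun w => ?_)
      rw [hn, Real.rpow_one, Real.norm_of_nonneg (Real.exp_pos _).le, add_mul, Real.exp_add,
        ← mul_assoc]
      refine mul_le_mul ?_ ?_ (Real.exp_pos _).le (by positivity)
      · refine (hBC _).trans ?_
        rw [norm_mul, norm_I, one_mul]
        exact mul_le_mul_of_nonneg_right (le_abs_self C) (Real.exp_pos _).le
      · rw [Real.exp_le_exp]
        refine (le_abs_self _).trans ?_
        rw [abs_mul, abs_neg]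
        exact mul_le_mul_of_nonneg_left (abs_re_le_norm w) (abs_nonneg _)
    · refine ⟨K, ?_⟩
      rw [eventually_map]
      filter_upwards [eventually_ge_atTop 0] with x hx
      rw [hn, ofReal_re]
      refine (mul_le_mul_of_nonneg_right (hK x hx) (Real.exp_pos _).le).trans ?_
      rw [mul_assoc, ← Real.exp_add, neg_mul, add_neg_cancel, Real.exp_zero, mul_one]
    · intro x
      rw [hn]
      have h1 : I * (x * I) = ((-x : ℝ) : ℂ) := by
        push_cast; linear_combination (x : ℂ) * I_mul_I
      rw [h1]
      simpa using hreal (-x)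
  have hlim : Tendsto (fun ε : ℝ => M * Real.exp ((s + ε) * z.im)) (𝓝[>] 0)
      (𝓝 (M * Real.exp (s * z.im))) := by
    refine Tendsto.mono_left (Continuous.tendsto' (by fun_prop) _ _ (by simp)) nhdsWithin_le_nhds
  exact ge_of_tendsto hlim (by filter_upwards [self_mem_nhdsWithin] with ε hε using key ε hε)

lemma exists_forall_norm_le_mul_exp {F : ℂ → ℂ} (hF : Continuous F) {c : ℂ} {t : ℝ} (ht : 0 ≤ t)
    (h : ∀ᶠ y : ℝ in atTop, ‖F (c * y)‖ ≤ Real.exp (t * y)) :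
    ∃ K : ℝ, 0 ≤ K ∧ ∀ y : ℝ, 0 ≤ y → ‖F (c * y)‖ ≤ K * Real.exp (t * y) := by
  obtain ⟨y₀, hy₀⟩ := eventually_atTop.1 h
  obtain ⟨K, hK⟩ := (isCompact_Icc (a := (0 : ℝ)) (b := y₀)).exists_bound_of_continuousOn
    (f := fun y : ℝ => F (c * y)) (by fun_prop)
  refine ⟨max K 1, by positivity, fun y hy => ?_⟩
  rcases le_total y₀ y with h1 | h1
  · exact (hy₀ y h1).trans (le_mul_of_one_le_left (Real.exp_pos _).le (le_max_right _ _))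
  · refine (hK y ⟨hy, h1⟩).trans ((le_max_left K 1).trans
      (le_mul_of_one_le_right (by positivity) (Real.one_le_exp (by positivity))))

/-- Integrals along a ray of a function of type `s` are of type `s`. -/
lemma norm_primitive_le_of_ray {F g : ℂ → ℂ} (hg : ∀ z, HasDerivAt g (F z) z) (hg0 : g 0 = 0)
    {c : ℂ} (hc : ‖c‖ = 1) {s : ℝ} (hs : 0 ≤ s)
    (him : ∀ ε : ℝ, 0 < ε → ∀ᶠ y : ℝ in atTop, ‖F (c * y)‖ ≤ Real.exp ((s + ε) * y))
    (ε : ℝ) (hε : 0 < ε) :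
    ∃ K : ℝ, ∀ y : ℝ, 0 ≤ y → ‖g (c * y)‖ ≤ K * Real.exp ((s + ε) * y) := by
  have hgd : Differentiable ℂ g := fun z => (hg z).differentiableAt
  have hF : Continuous F := by
    have : F = deriv g := funext fun z => (hg z).deriv.symm
    rw [this]
    exact (hgd.contDiff (n := 1)).continuous_deriv le_rfl
  -- Only `ε / 2` is spent on the integrand; the other half absorbs the length `y` of the ray.
  obtain ⟨K, hK0, hK⟩ := exists_forall_norm_le_mul_exp hF (by positivity) (him _ (half_pos hε))
  refine ⟨K * (2 / ε), fun y hy => ?_⟩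
  have h1 : ∀ t : ℝ, HasDerivAt (fun t : ℝ => g (c * t)) (F (c * t) * c) t := fun t => by
    have := (hg (c * t)).comp (t : ℂ) ((hasDerivAt_id (t : ℂ)).const_mul c)
    simpa using this.comp_ofReal
  have h2 := norm_image_sub_le_of_norm_deriv_le_segment' (f := fun t : ℝ => g (c * t))
    (f' := fun t : ℝ => F (c * t) * c) (a := 0) (b := y) (C := K * Real.exp ((s + ε / 2) * y))
    (fun t _ => (h1 t).hasDerivWithinAt) (fun t ht => by
      rw [norm_mul, hc, mul_one]
      refine (hK t ht.1).trans (mul_le_mul_of_nonneg_left ?_ hK0)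
      rw [Real.exp_le_exp]
      exact mul_le_mul_of_nonneg_left ht.2.le (by positivity)) y ⟨hy, le_rfl⟩
  simp only [ofReal_zero, mul_zero, hg0, sub_zero] at h2
  refine h2.trans ?_
  have h3 : y ≤ 2 / ε * Real.exp (ε / 2 * y) := by
    have := Real.add_one_le_exp (ε / 2 * y)
    calc y = 2 / ε * (ε / 2 * y) := by field_simp
      _ ≤ _ := by gcongr; linarith
  have h4 : Real.exp ((s + ε) * y) = Real.exp ((s + ε / 2) * y) * Real.exp (ε / 2 * y) := by
    rw [← Real.exp_add]; congr 1; ring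
  rw [h4]
  calc _ ≤ K * Real.exp ((s + ε / 2) * y) * (2 / ε * Real.exp (ε / 2 * y)) := by gcongr
    _ = _ := by ring

/-- An entire function of finite exponential type which is integrable on the real line, and of
type `s` along both imaginary half axes, is `O(exp (s |Im z|))`. -/
lemma exists_norm_le_exp_abs_im {F : ℂ → ℂ} {s : ℝ} (hF : Differentiable ℂ F)
    (hgrowth : ∃ B C : ℝ, ∀ z, ‖F z‖ ≤ C * Real.exp (B * ‖z‖))
    (hint : Integrable fun x : ℝ => F x) (hs : 0 ≤ s)
    (hup : ∀ ε : ℝ, 0 < ε → ∀ᶠ y : ℝ in atTop, ‖F (I * y)‖ ≤ Real.exp ((s + ε) * y))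
    (hdown : ∀ ε : ℝ, 0 < ε → ∀ᶠ y : ℝ in atTop, ‖F (-I * y)‖ ≤ Real.exp ((s + ε) * y)) :
    ∃ M : ℝ, 0 ≤ M ∧ ∀ z, ‖F z‖ ≤ M * Real.exp (s * |z.im|) := by
  -- Boundedness of `F` on the line is not known, but its primitive is bounded there by the `L¹`
  -- norm. The estimate is proved for `g` and transferred to `F = g'` by Cauchy on unit circles,
  -- which costs a factor `exp s`.
  obtain ⟨g, hg0, hg⟩ := hF.isExactOn_univ.with_val_at 0 0
  replace hg : ∀ z, HasDerivAt g (F z) z := fun z => hg z trivial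
  have hgd : Differentiable ℂ g := fun z => (hg z).differentiableAt
  set M : ℝ := ∫ x : ℝ, ‖F x‖
  have hM0 : 0 ≤ M := integral_nonneg fun _ => norm_nonneg _
  have hreal : ∀ x : ℝ, ‖g x‖ ≤ M := by
    intro x
    have h1 : ∫ t in (0 : ℝ)..x, F t = g x - g (0 : ℝ) :=
      intervalIntegral.integral_eq_sub_of_hasDerivAt (f := fun t : ℝ => g t)
        (fun t _ => (hg t).comp_ofReal) hint.intervalIntegrable
    rw [ofReal_zero, hg0, sub_zero] at h1
    rw [← h1]
    exact intervalIntegral.norm_integral_le_integral_norm_uIoc.trans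
      (setIntegral_le_integral hint.norm (Eventually.of_forall fun _ => norm_nonneg _))
  have hgg : ∃ B C : ℝ, ∀ z, ‖g z‖ ≤ C * Real.exp (B * ‖z‖) := by
    obtain ⟨B, C, hBC⟩ := hgrowth
    refine ⟨|B| + 1, |C|, fun z => ?_⟩
    have h1 := (convex_closedBall (0 : ℂ) ‖z‖).norm_image_sub_le_of_norm_hasDerivWithin_le
      (f := g) (f' := F) (C := |C| * Real.exp (|B| * ‖z‖)) (x := 0) (y := z)
      (fun w _ => (hg w).hasDerivWithinAt) (fun w hw => ?_) (by simp) (by simp)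
    · rw [hg0, sub_zero, sub_zero] at h1
      refine h1.trans ?_
      rw [add_mul, one_mul, Real.exp_add, ← mul_assoc]
      gcongr
      linarith [Real.add_one_le_exp ‖z‖]
    · refine (hBC w).trans ?_
      rw [mem_closedBall_zero_iff] at hw
      gcongr
      · exact le_abs_self _
      · exact le_abs_self _
  have hgi := norm_primitive_le_of_ray hg hg0 norm_I hs hup
  have hgi' := norm_primitive_le_of_ray hg hg0 (c := -I) (by simp) hs hdown
  have hall : ∀ z, ‖g z‖ ≤ M * Real.exp (s * |z.im|) := by
    intro z
    rcases le_total 0 z.im with h | h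
    · rw [abs_of_nonneg h]
      exact norm_le_exp_im_of_bounded_real hgd hgg hreal hgi h
    · have := norm_le_exp_im_of_bounded_real (Φ := fun w => g (-w)) (s := s) (M := M) (z := -z)
        (by fun_prop) ?_ (fun x => by simpa using hreal (-x)) ?_ (by simpa using h)
      · rw [abs_of_nonpos h]
        simpa using this
      · obtain ⟨B, C, h⟩ := hgg
        exact ⟨B, C, fun z => by simpa using h (-z)⟩
      · intro ε hε
        obtain ⟨K, hK⟩ := hgi' ε hε
        exact ⟨K, fun y hy => by simpa using hK y hy⟩
  refine ⟨M * Real.exp s, by positivity, fun z => ?_⟩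
  rw [← (hg z).deriv]
  have h := Complex.norm_deriv_le_of_forall_mem_sphere_norm_le (c := z) (R := 1)
    (C := M * Real.exp (s * (|z.im| + 1))) one_pos hgd.diffContOnCl fun w hw => by
      refine (hall w).trans ?_
      have h1 : |w.im| ≤ |z.im| + 1 := by
        have h2 : |(w - z).im| ≤ 1 := (abs_im_le_norm _).trans (mem_sphere_iff_norm.1 hw).le
        rw [sub_im] at h2
        linarith [abs_sub_abs_le_abs_sub w.im z.im]
      gcongr
  rw [div_one, mul_add, mul_one, Real.exp_add] at h
  linarith [h]

/-! ### Vanishing of integrals of bounded analytic functions in the half plane -/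

/-- The integral over the real line of an integrable function with a bounded analytic
continuation to the upper half plane vanishes. -/
lemma integral_eq_zero_of_bounded_upperHP {K : ℂ → ℂ} {M : ℝ}
    (hK : ∀ z : ℂ, 0 ≤ z.im → DifferentiableAt ℂ K z) (hM : ∀ z : ℂ, 0 ≤ z.im → ‖K z‖ ≤ M)
    (hint : Integrable fun x : ℝ => K x) : ∫ x : ℝ, K x = 0 := by
  have hM0 : 0 ≤ M := (norm_nonneg _).trans (hM 0 (by simp))
  have hlow : ∀ ε : ℝ, 0 < ε → ∀ z : ℂ, 0 ≤ z.im →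
      1 ≤ ‖1 - ε * I * z‖ ∧ ε * |z.re| ≤ ‖1 - ε * I * z‖ ∧ ε * z.im ≤ ‖1 - ε * I * z‖ := by
    intro ε hε z hz
    have hre : (1 - ε * I * z).re = 1 + ε * z.im := by simp
    have him : (1 - ε * I * z).im = -(ε * z.re) := by simp
    have h1 := abs_re_le_norm (1 - ε * I * z)
    have h2 := abs_im_le_norm (1 - ε * I * z)
    have h3 : 0 ≤ ε * z.im := by positivity
    rw [hre, abs_of_nonneg (by positivity)] at h1
    rw [him, abs_neg, abs_mul, abs_of_pos hε] at h2
    exact ⟨by linarith, h2, by linarith⟩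
  -- The factor `(1 - iεz)⁻²` has modulus at most one in the closed half plane and decays
  -- quadratically. The three other sides of the rectangle, of total length `4R`, then contribute
  -- `O(1/R)`, and `ε → 0` is dominated by `|K|`.
  set L : ℝ → ℂ → ℂ := fun ε z => K z / (1 - ε * I * z) ^ 2 with hL
  have hLd : ∀ ε : ℝ, 0 < ε → ∀ z : ℂ, 0 ≤ z.im → DifferentiableAt ℂ (L ε) z := by
    intro ε hε z hz
    have h0 : 1 - ε * I * z ≠ 0 := fun h => by
      have := (hlow ε hε z hz).1
      rw [h, norm_zero] at this
      linarith
    exact (hK z hz).div (by fun_prop) (pow_ne_zero 2 h0)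
  have hLn : ∀ ε : ℝ, 0 < ε → ∀ z : ℂ, 0 ≤ z.im → ‖L ε z‖ ≤ ‖K z‖ := by
    intro ε hε z hz
    rw [hL, norm_div, norm_pow]
    exact div_le_self (norm_nonneg _) (one_le_pow₀ (hlow ε hε z hz).1)
  have hLR : ∀ ε : ℝ, 0 < ε → ∀ R : ℝ, 0 < R → ∀ z : ℂ, 0 ≤ z.im →
      (R ≤ |z.re| ∨ R ≤ z.im) → ‖L ε z‖ ≤ M / (ε * R) ^ 2 := by
    intro ε hε R hR z hz h
    have h1 : ε * R ≤ ‖1 - ε * I * z‖ := by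
      obtain ⟨-, h2, h3⟩ := hlow ε hε z hz
      rcases h with h | h
      · exact (mul_le_mul_of_nonneg_left h hε.le).trans h2
      · exact (mul_le_mul_of_nonneg_left h hε.le).trans h3
    rw [hL, norm_div, norm_pow]
    exact div_le_div₀ hM0 (hM z hz) (by positivity) (pow_le_pow_left₀ (by positivity) h1 2)
  have hcont : Continuous fun x : ℝ => K x :=
    continuous_iff_continuousAt.2 fun x =>
      (hK x (by simp)).continuousAt.comp (f := fun x : ℝ => (x : ℂ)) continuous_ofReal.continuousAt
  have hLcont : ∀ ε : ℝ, 0 < ε → Continuous fun x : ℝ => L ε x := fun ε hε =>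
    continuous_iff_continuousAt.2 fun x => (hLd ε hε x (by simp)).continuousAt.comp
      (f := fun x : ℝ => (x : ℂ)) continuous_ofReal.continuousAt
  have hLint : ∀ ε : ℝ, 0 < ε → Integrable fun x : ℝ => L ε x := fun ε hε =>
    hint.mono (hLcont ε hε).aestronglyMeasurable
      (Eventually.of_forall fun x => hLn ε hε x (by simp))
  have hzero : ∀ ε : ℝ, 0 < ε → ∫ x : ℝ, L ε x = 0 := by
    intro ε hε
    have h1 : Tendsto (fun R : ℝ => ∫ x in (-R)..R, L ε x) atTop (𝓝 (∫ x : ℝ, L ε x)) :=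
      intervalIntegral_tendsto_integral (hLint ε hε) tendsto_neg_atTop_atBot tendsto_id
    refine tendsto_nhds_unique h1 ?_
    have hbd : ∀ R : ℝ, 0 < R → ‖∫ x in (-R)..R, L ε x‖ ≤ 4 * M / ε ^ 2 * R⁻¹ := by
      intro R hR
      have hrect := Complex.integral_boundary_rect_eq_zero_of_differentiableOn (L ε)
        ((-R : ℝ) : ℂ) (R + R * I) (fun z hz => by
          have hz' : z.im ∈ Set.uIcc 0 R := by simpa using hz.2
          rw [Set.uIcc_of_le hR.le] at hz'
          exact (hLd ε hε z hz'.1).differentiableWithinAt)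
      simp only [ofReal_re, ofReal_im, add_re, mul_re, I_re, mul_zero, I_im, mul_one, sub_zero,
        add_im, mul_im, add_zero, zero_add, ofReal_zero, zero_mul] at hrect
      have htop : ‖∫ x in (-R)..R, L ε (x + R * I)‖ ≤ M / (ε * R) ^ 2 * |R - -R| :=
        intervalIntegral.norm_integral_le_of_norm_le_const fun x _ =>
          hLR ε hε R hR _ (by simpa using hR.le) (Or.inr (by simp))
      have hside : ∀ r : ℝ, |r| = R →
          ‖∫ y in (0 : ℝ)..R, L ε (r + y * I)‖ ≤ M / (ε * R) ^ 2 * |R - 0| := fun r hr =>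
        intervalIntegral.norm_integral_le_of_norm_le_const fun y hy => by
          rw [Set.uIoc_of_le hR.le] at hy
          exact hLR ε hε R hR _ (by simpa using hy.1.le) (Or.inl (by simp [hr]))
      have hs1 := hside R (abs_of_pos hR)
      have hs2 := hside (-R) (by rw [abs_neg, abs_of_pos hR])
      rw [sub_zero, abs_of_pos hR] at hs1 hs2
      rw [sub_neg_eq_add, abs_of_pos (by positivity)] at htop
      have heq : ∫ x in (-R)..R, L ε x = (∫ x in (-R)..R, L ε (x + R * I)) -
          I • (∫ y in (0 : ℝ)..R, L ε (R + y * I)) +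
          I • ∫ y in (0 : ℝ)..R, L ε (((-R : ℝ) : ℂ) + y * I) := by
        linear_combination hrect
      rw [heq]
      refine (norm_add_le _ _).trans ?_
      refine (add_le_add_left (norm_sub_le _ _) _).trans ?_
      rw [norm_smul, norm_smul, norm_I, one_mul, one_mul]
      have : M / (ε * R) ^ 2 * (R + R) + M / (ε * R) ^ 2 * R + M / (ε * R) ^ 2 * R
          = 4 * M / ε ^ 2 * R⁻¹ := by
        field_simp; ring
      linarith
    refine squeeze_zero_norm' (a := fun R : ℝ => 4 * M / ε ^ 2 * R⁻¹) ?_ ?_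
    · filter_upwards [eventually_gt_atTop 0] with R hR using hbd R hR
    · simpa using (tendsto_inv_atTop_zero (𝕜 := ℝ)).const_mul (4 * M / ε ^ 2)
  have hlim : Tendsto (fun ε : ℝ => ∫ x : ℝ, L ε x) (𝓝[>] 0) (𝓝 (∫ x : ℝ, K x)) := by
    refine tendsto_integral_filter_of_dominated_convergence (fun x : ℝ => ‖K x‖) ?_ ?_ hint.norm ?_
    · filter_upwards [self_mem_nhdsWithin] with ε hε using (hLcont ε hε).aestronglyMeasurable
    · filter_upwards [self_mem_nhdsWithin] with ε hε
      exact Eventually.of_forall fun x => hLn ε hε x (by simp)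
    · refine Eventually.of_forall fun x => Tendsto.mono_left ?_ nhdsWithin_le_nhds
      have h : ContinuousAt (fun ε : ℝ => L ε x) 0 :=
        ContinuousAt.div (by fun_prop) (by fun_prop) (by simp)
      simpa [hL] using h.tendsto
  refine tendsto_nhds_unique hlim (tendsto_const_nhds.congr' ?_)
  filter_upwards [self_mem_nhdsWithin] with ε hε using (hzero ε hε).symm

/-! ### Functions of bounded type in both half planes have finite exponential type -/

/-- Jensen's inequality for analytic functions. -/
lemma log_norm_le_circleAverage {f : ℂ → ℂ} {c : ℂ} {R : ℝ} (hR : 0 < R)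
    (hf : AnalyticOnNhd ℂ f (Metric.closedBall c R)) (h0 : f c ≠ 0) :
    Real.log ‖f c‖ ≤ Real.circleAverage (fun z => Real.log ‖f z‖) c R := by
  have hf' : AnalyticOnNhd ℂ f (Metric.closedBall c |R|) := by rwa [abs_of_pos hR]
  rw [hf'.circleAverage_log_norm hR.ne' h0, le_add_iff_nonneg_left]
  refine finsum_nonneg fun u => ?_
  by_cases hu : u ∈ Metric.closedBall c |R|
  · have hd : 0 ≤ MeromorphicOn.divisor f (Metric.closedBall c |R|) u :=
      MeromorphicOn.AnalyticOnNhd.divisor_nonneg hf' u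
    refine mul_nonneg (by exact_mod_cast hd) ?_
    rw [Metric.mem_closedBall, abs_of_pos hR, dist_comm, dist_eq_norm] at hu
    rcases eq_or_ne ‖c - u‖ 0 with h | h
    · simp [h]
    · refine Real.log_nonneg ?_
      rw [← div_eq_mul_inv, le_div_iff₀ (by positivity)]
      linarith
  · simp [hu]

lemma circleIntegrable_posLog_norm {f : ℂ → ℂ} {c : ℂ} {R : ℝ} (hR : 0 ≤ R)
    (hf : ContinuousOn f (Metric.closedBall c R)) :
    CircleIntegrable (fun z => Real.posLog ‖f z‖) c R :=
  ContinuousOn.circleIntegrable hR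
    (Real.continuous_posLog.comp_continuousOn (hf.mono Metric.sphere_subset_closedBall).norm)

/-- Subharmonicity of `log⁺ |f|`: the mean is nonnegative, and it dominates `log |f c|` by Jensen.
-/
lemma posLog_norm_le_circleAverage {f : ℂ → ℂ} {c : ℂ} {R : ℝ} (hR : 0 < R)
    (hf : AnalyticOnNhd ℂ f (Metric.closedBall c R)) :
    Real.posLog ‖f c‖ ≤ Real.circleAverage (fun z => Real.posLog ‖f z‖) c R := by
  have h1 : 0 ≤ Real.circleAverage (fun z => Real.posLog ‖f z‖) c R :=
    Real.circleAverage_nonneg_of_nonneg fun _ _ => Real.posLog_nonneg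
  refine max_le h1 ?_
  by_cases h0 : f c = 0
  · simpa [h0] using h1
  refine (log_norm_le_circleAverage hR hf h0).trans (Real.circleAverage_mono
    ((hf.mono Metric.sphere_subset_closedBall).meromorphicOn.circleIntegrable_log_norm_of_nonneg
      hR.le) (circleIntegrable_posLog_norm hR.le hf.continuousOn) fun z _ => le_max_right _ _)

/-- The circle averages of `log⁺ |p / q|` for bounded `p`, `q`. -/
lemma circleAverage_posLog_le {f q : ℂ → ℂ} {R : ℝ} (hR : 0 < R)
    (hf : AnalyticOnNhd ℂ f (Metric.closedBall 0 R))
    (hq : AnalyticOnNhd ℂ q (Metric.closedBall 0 R))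
    (hq1 : ∀ z ∈ Metric.closedBall (0 : ℂ) R, ‖q z‖ ≤ 1)
    (hfq : ∀ z ∈ Metric.closedBall (0 : ℂ) R, ‖f z * q z‖ ≤ 1) (hq0 : q 0 ≠ 0) :
    Real.circleAverage (fun z => Real.posLog ‖f z‖) 0 R ≤ -Real.log ‖q 0‖ := by
  have hsub : Metric.sphere (0 : ℂ) |R| ⊆ Metric.closedBall 0 R := by
    rw [abs_of_pos hR]; exact Metric.sphere_subset_closedBall
  have hqi : CircleIntegrable (fun z => Real.log ‖q z‖) 0 R :=
    (hq.mono hsub).meromorphicOn.circleIntegrable_log_norm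
  have hfi := circleIntegrable_posLog_norm hR.le hf.continuousOn
  have hadd := Real.circleAverage_fun_add hfi hqi
  -- Where `q ≠ 0` the sum is `log max(|q|, |f q|) ≤ 0`. At a zero of `q` the convention `Real.log 0
  -- = 0` spoils this, so the integrand is replaced by 0 there; the zeros are discrete and do not
  -- affect the average.
  have hcod : (fun z => Real.posLog ‖f z‖ + Real.log ‖q z‖) =ᶠ[
      codiscreteWithin (Metric.sphere 0 |R|)]
      fun z => if q z = 0 then 0 else Real.posLog ‖f z‖ + Real.log ‖q z‖ := by
    have h1 := hq.preimage_zero_mem_codiscreteWithin hq0 (by simp [hR.le])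
      ⟨⟨0, by simp [hR.le]⟩, (convex_closedBall (0 : ℂ) R).isPreconnected⟩
    filter_upwards [codiscreteWithin_mono hsub h1] with z hz
    rw [if_neg (by simpa using hz)]
  rw [Real.circleAverage_congr_codiscreteWithin hcod hR.ne'] at hadd
  have hneg : 0 ≤ Real.circleAverage ((-1 : ℝ) • fun z =>
      if q z = 0 then 0 else Real.posLog ‖f z‖ + Real.log ‖q z‖) 0 R := by
    refine Real.circleAverage_nonneg_of_nonneg fun z hz => ?_
    simp only [Pi.smul_apply, smul_eq_mul, neg_mul, one_mul, Left.nonneg_neg_iff]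
    split_ifs with h
    · exact le_rfl
    · have hq' : 0 < ‖q z‖ := norm_pos_iff.2 h
      have h1 := hq1 z (hsub hz)
      have h2 := hfq z (hsub hz)
      rw [norm_mul] at h2
      rw [Real.posLog_eq_log_max_one (norm_nonneg _),
        ← Real.log_mul (by positivity) hq'.ne']
      refine Real.log_nonpos (by positivity) ?_
      rw [max_mul_of_nonneg _ _ hq'.le]
      exact max_le (by linarith) h2
  rw [Real.circleAverage_smul, smul_eq_mul] at hneg
  have := log_norm_le_circleAverage hR hq hq0
  linarith

/-! ### Area integrals of `log⁺ |f|` -/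

lemma lintegral_circle_posLog {f : ℂ → ℂ} {c : ℂ} {R : ℝ} (hR : 0 ≤ R)
    (hf : ContinuousOn f (Metric.closedBall c R)) :
    ∫⁻ θ in Set.Ioo (-Real.pi) Real.pi, ENNReal.ofReal (Real.posLog ‖f (circleMap c R θ)‖) =
      ENNReal.ofReal (2 * Real.pi * Real.circleAverage (fun z => Real.posLog ‖f z‖) c R) := by
  have hcont : Continuous fun θ => Real.posLog ‖f (circleMap c R θ)‖ :=
    Real.continuous_posLog.comp (hf.comp_continuous (continuous_circleMap c R)
      fun θ => circleMap_mem_closedBall c hR θ).norm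
  have h1 : IntegrableOn (fun θ => Real.posLog ‖f (circleMap c R θ)‖)
      (Set.Ioo (-Real.pi) Real.pi) :=
    (hcont.integrableOn_Icc (a := -Real.pi) (b := Real.pi)).mono_set Set.Ioo_subset_Icc_self
  rw [← ofReal_integral_eq_lintegral_ofReal h1
    (Eventually.of_forall fun _ => Real.posLog_nonneg),
    Real.circleAverage_eq_integral_add (-Real.pi),
    intervalIntegral.integral_comp_add_right (fun θ => Real.posLog ‖f (circleMap c R θ)‖),
    ← integral_Ioc_eq_integral_Ioo, ← intervalIntegral.integral_of_le (by linarith [Real.pi_pos]),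
    smul_eq_mul, ← mul_assoc, mul_inv_cancel₀ (by positivity), one_mul]
  congr 2 <;> ring

lemma lintegral_eq_lintegral_circle (u : ℂ → ℝ≥0∞) (hu : Measurable u) (c : ℂ) :
    ∫⁻ z, u z = ∫⁻ r in Set.Ioi (0 : ℝ), ENNReal.ofReal r *
      ∫⁻ θ in Set.Ioo (-Real.pi) Real.pi, u (circleMap c r θ) := by
  have hpol : ∀ p : ℝ × ℝ, c + Complex.polarCoord.symm p = circleMap c p.1 p.2 := fun p => by
    rw [Complex.polarCoord_symm_apply, circleMap, exp_mul_I, ofReal_cos, ofReal_sin]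
  have hm : Measurable fun p : ℝ × ℝ => u (circleMap c p.1 p.2) := by
    refine hu.comp (Continuous.measurable ?_)
    unfold circleMap
    fun_prop
  rw [← lintegral_add_left_eq_self u c, ← Complex.lintegral_comp_polarCoord_symm]
  simp only [hpol, smul_eq_mul]
  rw [show polarCoord.target = Set.Ioi (0 : ℝ) ×ˢ Set.Ioo (-Real.pi) Real.pi from rfl,
    Measure.volume_eq_prod, ← Measure.prod_restrict,
    lintegral_prod (fun p : ℝ × ℝ => ENNReal.ofReal p.1 * u (circleMap c p.1 p.2))
      ((ENNReal.measurable_ofReal.comp measurable_fst).mul hm).aemeasurable]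
  refine lintegral_congr fun r => ?_
  have hr : Measurable fun θ => u (circleMap c r θ) := hu.comp (measurable_circleMap c r)
  rw [← lintegral_const_mul _ hr]

/-- In polar coordinates the radii fill an interval of length `2δ` and are at most 2, whence `4δ`.
The circle `r = 1`, on which no bound is assumed, is negligible. -/
lemma lintegral_annulus_le {u : ℂ → ℝ≥0∞} (hu : Measurable u) {K : ℝ≥0∞}
    (hK : ∀ r : ℝ, 0 < r → r ≠ 1 →
      ∫⁻ θ in Set.Ioo (-Real.pi) Real.pi, u (circleMap 0 r θ) ≤ K)
    {δ : ℝ} (hδ1 : δ ≤ 1) :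
    ∫⁻ z in {z : ℂ | 1 - δ < ‖z‖ ∧ ‖z‖ < 1 + δ}, u z ≤ K * ENNReal.ofReal (4 * δ) := by
  have hA : MeasurableSet {z : ℂ | 1 - δ < ‖z‖ ∧ ‖z‖ < 1 + δ} :=
    (measurableSet_lt measurable_const measurable_norm).inter
      (measurableSet_lt measurable_norm measurable_const)
  rw [← lintegral_indicator hA, lintegral_eq_lintegral_circle _ (hu.indicator hA) 0]
  have h1 : ∀ r ∈ Set.Ioi (0 : ℝ), r ≠ 1 → ENNReal.ofReal r *
      ∫⁻ θ in Set.Ioo (-Real.pi) Real.pi,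
        {z : ℂ | 1 - δ < ‖z‖ ∧ ‖z‖ < 1 + δ}.indicator u (circleMap 0 r θ) ≤
      (Set.Ioo (1 - δ) (1 + δ)).indicator (fun _ => ENNReal.ofReal 2 * K) r := by
    intro r hr hr1
    have hn : ∀ θ, ‖circleMap 0 r θ‖ = r := fun θ => by
      rw [norm_circleMap_zero, abs_of_pos hr]
    by_cases h : r ∈ Set.Ioo (1 - δ) (1 + δ)
    · rw [Set.indicator_of_mem h]
      refine mul_le_mul' (ENNReal.ofReal_le_ofReal (by linarith [h.2]))
        ((lintegral_mono fun θ => ?_).trans (hK r hr hr1))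
      exact Set.indicator_le_self _ _ _
    · rw [Set.indicator_of_notMem h]
      have : ∀ θ, {z : ℂ | 1 - δ < ‖z‖ ∧ ‖z‖ < 1 + δ}.indicator u (circleMap 0 r θ) = 0 := by
        intro θ
        refine Set.indicator_of_notMem (fun hθ => h ?_) _
        rw [Set.mem_ofPred_eq, hn] at hθ
        exact hθ
      simp [this]
  calc _ ≤ ∫⁻ r in Set.Ioi (0 : ℝ),
        (Set.Ioo (1 - δ) (1 + δ)).indicator (fun _ => ENNReal.ofReal 2 * K) r := by
        refine lintegral_mono_ae ?_
        filter_upwards [ae_restrict_mem measurableSet_Ioi,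
          ae_restrict_of_ae (Measure.ae_ne volume (1 : ℝ))] with r hr hr1 using h1 r hr hr1
    _ ≤ ∫⁻ r, (Set.Ioo (1 - δ) (1 + δ)).indicator (fun _ => ENNReal.ofReal 2 * K) r :=
        setLIntegral_le_lintegral _ _
    _ = K * ENNReal.ofReal (4 * δ) := by
        rw [lintegral_indicator measurableSet_Ioo, setLIntegral_const, Real.volume_Ioo,
          mul_comm (ENNReal.ofReal 2), mul_assoc, ← ENNReal.ofReal_mul (by norm_num)]
        congr 2; ring

/-- A weak form of the sub-mean value property over discs. -/
lemma posLog_norm_mul_le_lintegral_ball {f : ℂ → ℂ} (hfm : Measurable f) {w : ℂ} {ρ : ℝ}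
    (hρ : 0 < ρ) (hf : AnalyticOnNhd ℂ f (Metric.closedBall w ρ)) :
    ENNReal.ofReal (Real.pi / 2 * ρ ^ 2 * Real.posLog ‖f w‖) ≤
      ∫⁻ z in Metric.ball w ρ, ENNReal.ofReal (Real.posLog ‖f z‖) := by
  have hu : Measurable fun z => ENNReal.ofReal (Real.posLog ‖f z‖) :=
    ENNReal.measurable_ofReal.comp (Real.continuous_posLog.measurable.comp hfm.norm)
  rw [← lintegral_indicator measurableSet_ball,
    lintegral_eq_lintegral_circle _ (hu.indicator measurableSet_ball) w]
  -- Keeping only radii above `ρ / 2` bounds the Jacobian below by `ρ / 2`; this gives `(ρ / 2) · (ρ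
  -- / 2) · 2π = (π / 2) ρ²`.
  have h1 : ∀ r ∈ Set.Ioo (ρ / 2) ρ,
      ENNReal.ofReal (ρ / 2 * (2 * Real.pi * Real.posLog ‖f w‖)) ≤ ENNReal.ofReal r *
      ∫⁻ θ in Set.Ioo (-Real.pi) Real.pi, (Metric.ball w ρ).indicator
        (fun z => ENNReal.ofReal (Real.posLog ‖f z‖)) (circleMap w r θ) := by
    intro r hr
    have hr0 : 0 < r := by linarith [hr.1]
    have hsub : Metric.closedBall w r ⊆ Metric.closedBall w ρ :=
      Metric.closedBall_subset_closedBall hr.2.le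
    have hmem : ∀ θ, circleMap w r θ ∈ Metric.ball w ρ := fun θ => by
      rw [Metric.mem_ball, dist_eq_norm, circleMap_sub_center, norm_circleMap_zero,
        abs_of_pos hr0]
      exact hr.2
    simp only [Set.indicator_of_mem (hmem _)]
    rw [lintegral_circle_posLog hr0.le (hf.continuousOn.mono hsub),
      ← ENNReal.ofReal_mul hr0.le]
    refine ENNReal.ofReal_le_ofReal ?_
    have := posLog_norm_le_circleAverage hr0 (hf.mono hsub)
    have h0 : 0 ≤ Real.posLog ‖f w‖ := Real.posLog_nonneg
    have h2 := Real.pi_pos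
    gcongr
    exact hr.1.le
  calc _ = ∫⁻ _ in Set.Ioo (ρ / 2) ρ,
        ENNReal.ofReal (ρ / 2 * (2 * Real.pi * Real.posLog ‖f w‖)) := by
        rw [setLIntegral_const, Real.volume_Ioo, ← ENNReal.ofReal_mul' (by linarith)]
        congr 1; ring
    _ ≤ _ := setLIntegral_mono' measurableSet_Ioo h1
    _ ≤ _ := lintegral_mono_set fun r hr => by
        have := hr.1
        exact Set.mem_Ioi.2 (by linarith)

/-- A function analytic away from `1` with bounded circle integrals of `log⁺ |f|` grows at most
like `exp (C / |1 - w|)` near `1`. -/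
lemma posLog_norm_le_div {f : ℂ → ℂ} (hfm : Measurable f)
    (hf : ∀ w : ℂ, w ≠ 1 → AnalyticAt ℂ f w) {K : ℝ} (hK0 : 0 ≤ K)
    (hK : ∀ r : ℝ, 0 < r → r ≠ 1 → ∫⁻ θ in Set.Ioo (-Real.pi) Real.pi,
      ENNReal.ofReal (Real.posLog ‖f (circleMap 0 r θ)‖) ≤ ENNReal.ofReal K)
    {w : ℂ} (hw : w ≠ 1) (hw' : ‖1 - w‖ ≤ 1 / 2) :
    Real.posLog ‖f w‖ ≤ 48 * K / (Real.pi * ‖1 - w‖) := by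
  set d := ‖1 - w‖ with hd
  have hd0 : 0 < d := norm_pos_iff.2 (sub_ne_zero.2 hw.symm)
  have hu : Measurable fun z => ENNReal.ofReal (Real.posLog ‖f z‖) :=
    ENNReal.measurable_ofReal.comp (Real.continuous_posLog.measurable.comp hfm.norm)
  have h1 := posLog_norm_mul_le_lintegral_ball hfm (half_pos hd0) (w := w) (fun z hz => by
    refine hf z fun h => ?_
    rw [h, Metric.mem_closedBall, dist_eq_norm, ← hd] at hz
    linarith)
  -- The disc of radius `d / 2` about `w` lies within `3d / 2` of 1, hence in this annulus.
  -- Comparison gives `(π / 8) d² log⁺ |f w| ≤ 6 d K`, the source of 48.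
  have h2 := lintegral_annulus_le hu hK (δ := 3 * d / 2) (by linarith)
  have hsub : Metric.ball w (d / 2) ⊆
      {z : ℂ | 1 - 3 * d / 2 < ‖z‖ ∧ ‖z‖ < 1 + 3 * d / 2} := by
    intro z hz
    rw [Metric.mem_ball, dist_eq_norm] at hz
    have e : ‖1 - z‖ < 3 * d / 2 := by
      calc ‖1 - z‖ = ‖(1 - w) - (z - w)‖ := by congr 1; ring
        _ ≤ ‖1 - w‖ + ‖z - w‖ := norm_sub_le _ _
        _ < _ := by linarith
    have e1 := norm_sub_norm_le (1 : ℂ) z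
    have e2 := norm_sub_norm_le z (1 : ℂ)
    rw [norm_one] at e1 e2
    rw [norm_sub_rev] at e2
    exact ⟨by linarith, by linarith⟩
  have h3 := h1.trans ((lintegral_mono_set hsub).trans h2)
  rw [← ENNReal.ofReal_mul hK0, ENNReal.ofReal_le_ofReal_iff (by positivity)] at h3
  rw [le_div_iff₀ (by positivity)]
  have h4 : d * (Real.posLog ‖f w‖ * (Real.pi * d)) ≤ d * (48 * K) := by
    nlinarith
  exact le_of_mul_le_mul_left h4 hd0

/-! ### Transfer to the unit disc and Krein's theorem -/

/-- The Möbius map taking the unit disc onto the upper half plane and `0` to `z₀`. -/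
noncomputable def discToUpperHP (z₀ w : ℂ) : ℂ := (z₀ - conj z₀ * w) / (1 - w)

lemma discToUpperHP_im (z₀ : ℂ) {w : ℂ} (hw : w ≠ 1) :
    (discToUpperHP z₀ w).im = z₀.im * (1 - ‖w‖ ^ 2) / ‖1 - w‖ ^ 2 := by
  have h : normSq (1 - w) ≠ 0 := (map_ne_zero _).2 (sub_ne_zero.2 hw.symm)
  rw [discToUpperHP, div_im, ← normSq_eq_norm_sq, ← normSq_eq_norm_sq, ← sub_div]
  congr 1
  simp only [normSq_apply, sub_im, sub_re, mul_im, mul_re, conj_re, conj_im, one_re, one_im]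
  ring

lemma discToUpperHP_mem {z₀ w : ℂ} (hz₀ : z₀ ∈ upperHP) (hw : ‖w‖ < 1) :
    discToUpperHP z₀ w ∈ upperHP := by
  have h1 : w ≠ 1 := fun h => by simp [h] at hw
  have h2 : 0 < ‖1 - w‖ := norm_pos_iff.2 (sub_ne_zero.2 h1.symm)
  have h3 : 0 < z₀.im := hz₀
  have h4 : 0 < 1 - ‖w‖ ^ 2 := by nlinarith [norm_nonneg w]
  change 0 < (discToUpperHP z₀ w).im
  rw [discToUpperHP_im z₀ h1]
  positivity

/-- Reflection in the unit circle corresponds to reflection in the real axis, so `F` outside the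
disc is controlled by `F^*` inside it. -/
lemma conj_discToUpperHP (z₀ : ℂ) {w : ℂ} (hw : w ≠ 0) :
    conj (discToUpperHP z₀ w) = discToUpperHP z₀ (conj w)⁻¹ := by
  have hw' : conj w ≠ 0 := (map_ne_zero _).2 hw
  -- At the pole both sides are 0 by the convention for division by zero.
  by_cases h1 : 1 - conj w = 0
  · have : conj w = 1 := (sub_eq_zero.1 h1).symm
    simp [discToUpperHP, this]
  · have h2 : 1 - (conj w)⁻¹ ≠ 0 := by
      intro h
      apply h1
      field_simp at h
      linear_combination -h
    simp only [discToUpperHP, map_div₀, map_sub, map_mul, conj_conj, map_one]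
    rw [div_eq_div_iff h1 h2]
    field_simp
    ring

lemma discToUpperHP_div {z₀ z : ℂ} (hz₀ : z₀ ∈ upperHP) (hz : z ≠ conj z₀) :
    discToUpperHP z₀ ((z - z₀) / (z - conj z₀)) = z := by
  have h1 : z - conj z₀ ≠ 0 := sub_ne_zero.2 hz
  have h2 : z₀ - conj z₀ ≠ 0 := by
    intro h
    have := congrArg Complex.im h
    simp only [sub_im, conj_im, zero_im] at this
    have h3 : 0 < z₀.im := hz₀
    linarith
  have h3 : 1 - (z - z₀) / (z - conj z₀) = (z₀ - conj z₀) / (z - conj z₀) := by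
    field_simp; ring
  rw [discToUpperHP, h3]
  field_simp
  ring

lemma analyticAt_discToUpperHP (z₀ : ℂ) {w : ℂ} (hw : w ≠ 1) :
    AnalyticAt ℂ (discToUpperHP z₀) w := by
  have : 1 - w ≠ 0 := sub_ne_zero.2 hw.symm
  unfold discToUpperHP
  fun_prop (disch := assumption)

lemma measurable_discToUpperHP (z₀ : ℂ) : Measurable (discToUpperHP z₀) := by
  unfold discToUpperHP
  fun_prop

/-- In the definition of bounded type both functions may be taken bounded by one. -/
lemma IsBoundedType.exists_norm_le_one {F : ℂ → ℂ} (hF : IsBoundedType F) :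
    ∃ P Q : ℂ → ℂ, DifferentiableOn ℂ P upperHP ∧ DifferentiableOn ℂ Q upperHP ∧
      (∀ z ∈ upperHP, ‖P z‖ ≤ 1) ∧ (∀ z ∈ upperHP, ‖Q z‖ ≤ 1) ∧
      (∃ z ∈ upperHP, Q z ≠ 0) ∧ ∀ z ∈ upperHP, F z * Q z = P z := by
  obtain ⟨-, P, Q, hP, hQ, ⟨M, hM⟩, ⟨N, hN⟩, ⟨z₁, hz₁, hne⟩, h⟩ := hF
  set T : ℝ := |M| + |N| + 1
  have hT : 0 < T := by positivity
  have hTn : ‖((T⁻¹ : ℝ) : ℂ)‖ = T⁻¹ := by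
    rw [norm_real, Real.norm_of_nonneg (by positivity)]
  have hle : ∀ {x : ℂ} {A : ℝ}, ‖x‖ ≤ A → A ≤ T → ‖((T⁻¹ : ℝ) : ℂ) * x‖ ≤ 1 := by
    intro x A h1 h2
    rw [norm_mul, hTn, inv_mul_le_iff₀ hT]
    linarith
  refine ⟨fun z => ((T⁻¹ : ℝ) : ℂ) * P z, fun z => ((T⁻¹ : ℝ) : ℂ) * Q z, hP.const_mul _,
    hQ.const_mul _, fun z hz => hle (hM z hz) ?_, fun z hz => hle (hN z hz) ?_, ⟨z₁, hz₁, ?_⟩,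
    fun z hz => ?_⟩
  · linarith [le_abs_self M, abs_nonneg N]
  · linarith [le_abs_self N, abs_nonneg M]
  · exact mul_ne_zero (by exact_mod_cast (inv_pos.2 hT).ne') hne
  · simp only [← h z hz]; ring

/-- In the disc coordinate `F` is a quotient of functions bounded by one, so its Nevanlinna mean is
at most `-log |Q z₀|`, uniformly in `r < 1`. -/
lemma lintegral_circle_discToUpperHP_le {F P Q : ℂ → ℂ} (hF : Differentiable ℂ F)
    (hQ : DifferentiableOn ℂ Q upperHP) (hP1 : ∀ z ∈ upperHP, ‖P z‖ ≤ 1)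
    (hQ1 : ∀ z ∈ upperHP, ‖Q z‖ ≤ 1) (h : ∀ z ∈ upperHP, F z * Q z = P z)
    {z₀ : ℂ} (hz₀ : z₀ ∈ upperHP) (hne : Q z₀ ≠ 0) {r : ℝ} (hr0 : 0 < r) (hr1 : r < 1) :
    ∫⁻ θ in Set.Ioo (-Real.pi) Real.pi,
      ENNReal.ofReal (Real.posLog ‖F (discToUpperHP z₀ (circleMap 0 r θ))‖) ≤
      ENNReal.ofReal (2 * Real.pi * -Real.log ‖Q z₀‖) := by
  have hlt : ∀ w ∈ Metric.closedBall (0 : ℂ) r, ‖w‖ < 1 := fun w hw =>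
    (mem_closedBall_zero_iff.1 hw).trans_lt hr1
  have hmem := fun w hw => discToUpperHP_mem hz₀ (hlt w hw)
  have han : ∀ w ∈ Metric.closedBall (0 : ℂ) r, AnalyticAt ℂ (discToUpperHP z₀) w :=
    fun w hw => analyticAt_discToUpperHP z₀ fun h => by simpa [h] using hlt w hw
  have hf : AnalyticOnNhd ℂ (fun w => F (discToUpperHP z₀ w)) (Metric.closedBall 0 r) :=
    fun w hw => (hF.analyticAt _).comp (han w hw)
  have hq : AnalyticOnNhd ℂ (fun w => Q (discToUpperHP z₀ w)) (Metric.closedBall 0 r) :=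
    fun w hw => (hQ.analyticAt (isOpen_upperHP.mem_nhds (hmem w hw))).comp (han w hw)
  have h0 : discToUpperHP z₀ 0 = z₀ := by simp [discToUpperHP]
  rw [lintegral_circle_posLog (f := fun w => F (discToUpperHP z₀ w)) hr0.le hf.continuousOn]
  refine ENNReal.ofReal_le_ofReal (mul_le_mul_of_nonneg_left ?_ (by positivity))
  have := circleAverage_posLog_le hr0 hf hq (fun w hw => hQ1 _ (hmem w hw))
    (fun w hw => by rw [h _ (hmem w hw)]; exact hP1 _ (hmem w hw)) (by rwa [h0])
  rwa [h0] at this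

lemma differentiable_starFn {F : ℂ → ℂ} (hF : Differentiable ℂ F) : Differentiable ℂ (starFn F) :=
  fun _ => differentiableAt_conj_conj_iff.2 (hF _)

/-- **Krein's theorem**, in the form: an entire function of bounded type in the upper and in the
lower half plane has finite exponential type. -/
theorem exists_norm_le_exp_of_isBoundedType {F : ℂ → ℂ} (hF : Differentiable ℂ F)
    (h1 : IsBoundedType F) (h2 : IsBoundedType (starFn F)) :
    ∃ B C : ℝ, ∀ z, ‖F z‖ ≤ C * Real.exp (B * ‖z‖) := by
  have hF' := differentiable_starFn hF
  obtain ⟨P₁, Q₁, -, hQ₁, hP₁1, hQ₁1, hne₁, he₁⟩ := h1.exists_norm_le_one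
  obtain ⟨P₂, Q₂, -, hQ₂, hP₂1, hQ₂1, hne₂, he₂⟩ := h2.exists_norm_le_one
  -- One centre must serve both `F` and `F^*`, since a single Möbius map is used inside and outside
  -- the unit circle.
  obtain ⟨z₀, hz₀, hne⟩ := exists_mul_ne_zero hQ₁ hQ₂ hne₁ hne₂
  have hb₁ := fun r => lintegral_circle_discToUpperHP_le (r := r) hF hQ₁ hP₁1 hQ₁1 he₁ hz₀
    (left_ne_zero_of_mul hne)
  have hb₂ := fun r => lintegral_circle_discToUpperHP_le (r := r) hF' hQ₂ hP₂1 hQ₂1 he₂ hz₀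
    (right_ne_zero_of_mul hne)
  set K : ℝ := max (max (2 * Real.pi * -Real.log ‖Q₁ z₀‖) (2 * Real.pi * -Real.log ‖Q₂ z₀‖)) 0
  have hK₁ : 2 * Real.pi * -Real.log ‖Q₁ z₀‖ ≤ K := (le_max_left _ _).trans (le_max_left _ _)
  have hK₂ : 2 * Real.pi * -Real.log ‖Q₂ z₀‖ ≤ K := (le_max_right _ _).trans (le_max_left _ _)
  have hK : ∀ r : ℝ, 0 < r → r ≠ 1 → ∫⁻ θ in Set.Ioo (-Real.pi) Real.pi,
      ENNReal.ofReal (Real.posLog ‖F (discToUpperHP z₀ (circleMap 0 r θ))‖) ≤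
        ENNReal.ofReal K := by
    intro r hr hr1
    rcases lt_or_gt_of_ne hr1 with h | h
    · exact (hb₁ r hr h).trans (ENNReal.ofReal_le_ofReal hK₁)
    · refine le_trans (le_of_eq ?_) ((hb₂ r⁻¹ (inv_pos.2 hr) (inv_lt_one_of_one_lt₀ h)).trans
        (ENNReal.ofReal_le_ofReal hK₂))
      refine lintegral_congr fun θ => ?_
      have hne : circleMap 0 r⁻¹ θ ≠ 0 := circleMap_ne_center (inv_pos.2 hr).ne'
      have e : (conj (circleMap 0 r⁻¹ θ))⁻¹ = circleMap 0 r θ := by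
        simp only [circleMap, zero_add, map_mul, conj_ofReal, ← exp_conj, conj_I, mul_inv,
          ← Complex.exp_neg]
        simp
      rw [starFn, norm_conj, conj_discToUpperHP z₀ hne, e]
  have hm : Measurable fun w => F (discToUpperHP z₀ w) :=
    hF.continuous.measurable.comp (measurable_discToUpperHP z₀)
  have hy : 0 < z₀.im := hz₀
  -- The disc coordinate `w` of `z` satisfies `|1 - w| = 2 Im z₀ / |z - conj z₀|`, so a bound `O(1 /
  -- |1 - w|)` is linear in `|z|`. The threshold `4 Im z₀` is what makes `|1 - w| ≤ 1/2`.
  have hfar : ∀ z : ℂ, 4 * z₀.im ≤ ‖z - conj z₀‖ →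
      ‖F z‖ ≤ Real.exp (24 * K / (Real.pi * z₀.im) * ‖z - conj z₀‖) := by
    intro z hz
    have hzpos : 0 < ‖z - conj z₀‖ := by linarith
    have hz1 : z - conj z₀ ≠ 0 := norm_pos_iff.1 hzpos
    have h3 : 1 - (z - z₀) / (z - conj z₀) = (z₀ - conj z₀) / (z - conj z₀) := by
      field_simp; ring
    have h4 : ‖1 - (z - z₀) / (z - conj z₀)‖ = 2 * z₀.im / ‖z - conj z₀‖ := by
      rw [h3, norm_div, sub_conj, norm_mul, norm_I, mul_one, norm_real,
        Real.norm_of_nonneg (by positivity)]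
    have h5 : (z - z₀) / (z - conj z₀) ≠ 1 := by
      intro h
      rw [h, sub_self, norm_zero] at h4
      have : 0 < 2 * z₀.im / ‖z - conj z₀‖ := by positivity
      linarith
    have h6 := posLog_norm_le_div hm (fun w hw => (hF.analyticAt _).comp
      (analyticAt_discToUpperHP z₀ hw)) (le_max_right _ _) hK h5 (by
        rw [h4, div_le_iff₀ hzpos]; linarith)
    rw [discToUpperHP_div hz₀ (sub_ne_zero.1 hz1), h4] at h6
    by_cases h0 : F z = 0
    · rw [h0, norm_zero]; positivity
    · rw [← Real.log_le_iff_le_exp (norm_pos_iff.2 h0)]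
      refine (le_max_right _ _).trans (h6.trans (le_of_eq ?_))
      change 48 * K / (Real.pi * (2 * z₀.im / ‖z - conj z₀‖)) = _
      field_simp
      ring
  obtain ⟨D, hD⟩ := (isCompact_closedBall (conj z₀) (4 * z₀.im)).exists_bound_of_continuousOn
    hF.continuous.continuousOn
  have hK0 : 0 ≤ K := le_max_right _ _
  set B := 24 * K / (Real.pi * z₀.im) with hB
  have hB0 : 0 ≤ B := by positivity
  refine ⟨B, max D 1 * Real.exp (B * ‖z₀‖), fun z => ?_⟩
  have h8 : ‖F z‖ ≤ max D 1 * Real.exp (B * ‖z - conj z₀‖) := by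
    rcases le_total (4 * z₀.im) ‖z - conj z₀‖ with h | h
    · exact (hfar z h).trans (le_mul_of_one_le_left (Real.exp_pos _).le (le_max_right _ _))
    · exact (hD z (by rwa [Metric.mem_closedBall, dist_eq_norm])).trans ((le_max_left D 1).trans
        (le_mul_of_one_le_right (by positivity) (Real.one_le_exp (by positivity))))
  refine h8.trans ?_
  rw [mul_assoc, ← Real.exp_add, ← mul_add]
  gcongr
  refine (norm_sub_le _ _).trans (le_of_eq ?_)
  rw [norm_conj, add_comm]

/-! ### The entire function `sin (π w) / w` -/

/-- The entire function `sin (π w) / w`. -/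
noncomputable def sincPi (w : ℂ) : ℂ :=
  if w = 0 then (Real.pi : ℂ) else Complex.sin (Real.pi * w) / w

/-- The function is the difference quotient of `sin πw` at 0, whose singularity `dslope` removes. -/
lemma differentiable_sincPi : Differentiable ℂ sincPi := by
  have h : sincPi = dslope (fun w : ℂ => Complex.sin (Real.pi * w)) 0 := by
    ext w
    by_cases hw : w = 0
    · subst hw
      have : HasDerivAt (fun w : ℂ => Complex.sin (Real.pi * w)) (Real.pi : ℂ) 0 := by
        simpa using ((hasDerivAt_id (0 : ℂ)).const_mul (Real.pi : ℂ)).csin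
      rw [dslope_same, this.deriv, sincPi, if_pos rfl]
    · rw [dslope_of_ne _ hw, slope_def_field, sincPi, if_neg hw]
      simp
  rw [h, ← differentiableOn_univ]
  exact (Complex.differentiableOn_dslope univ_mem).2 (by fun_prop)

lemma sincPi_neg (w : ℂ) : sincPi (-w) = sincPi w := by
  unfold sincPi
  simp [Complex.sin_neg]

lemma conj_sincPi (w : ℂ) : conj (sincPi w) = sincPi (conj w) := by
  unfold sincPi
  by_cases hw : w = 0
  · simp [hw]
  · rw [if_neg hw, if_neg ((map_ne_zero _).2 hw), map_div₀, ← Complex.sin_conj, map_mul,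
      conj_ofReal]

lemma norm_sin_sq (w : ℂ) :
    ‖Complex.sin w‖ ^ 2 = Real.sin w.re ^ 2 + Real.sinh w.im ^ 2 := by
  rw [Complex.sin_eq, ← normSq_eq_norm_sq, ← ofReal_sin, ← ofReal_cos, ← ofReal_sinh,
    ← ofReal_cosh, ← ofReal_mul, ← ofReal_mul, normSq_add_mul_I]
  linear_combination Real.sin w.re ^ 2 * Real.cosh_sq w.im +
    Real.sinh w.im ^ 2 * Real.sin_sq_add_cos_sq w.re

lemma norm_sincPi_sq {w : ℂ} (hw : w ≠ 0) : ‖sincPi w‖ ^ 2 =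
    (Real.sin (Real.pi * w.re) ^ 2 + Real.sinh (Real.pi * w.im) ^ 2) / (w.re ^ 2 + w.im ^ 2) := by
  rw [sincPi, if_neg hw, norm_div, div_pow, norm_sin_sq, re_ofReal_mul, im_ofReal_mul,
    ← normSq_eq_norm_sq w, normSq_apply, sq w.re, sq w.im]

lemma norm_sincPi_le {w : ℂ} (hw : w ≠ 0) :
    ‖sincPi w‖ ≤ Real.exp (Real.pi * |w.im|) / ‖w‖ := by
  rw [sincPi, if_neg hw, norm_div]
  gcongr
  have h1 : ‖Complex.sin (Real.pi * w)‖ ≤ Real.cosh (Real.pi * w.im) := by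
    refine le_of_sq_le_sq ?_ (Real.cosh_pos _).le
    rw [norm_sin_sq, re_ofReal_mul, im_ofReal_mul, Real.cosh_sq]
    linarith [Real.sin_sq_le_one (Real.pi * w.re)]
  refine h1.trans ?_
  rw [← Real.cosh_abs, abs_mul, abs_of_pos Real.pi_pos]
  rw [← Real.cosh_add_sinh]
  linarith [Real.sinh_nonneg_iff.2 (show 0 ≤ Real.pi * |w.im| by positivity)]

lemma norm_sincPi_I_mul {t : ℝ} (ht : 0 < t) :
    ‖sincPi (I * t)‖ = Real.sinh (Real.pi * t) / t := by
  have h0 : I * (t : ℂ) ≠ 0 := mul_ne_zero I_ne_zero (by exact_mod_cast ht.ne')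
  have h1 : 0 < Real.sinh (Real.pi * t) := Real.sinh_pos_iff.2 (by positivity)
  rw [← sq_eq_sq₀ (norm_nonneg _) (by positivity), norm_sincPi_sq h0]
  simp [div_pow]

/-! ### Growth of `|sin πw / w|` along vertical lines -/

lemma strictConvexOn_sinh : StrictConvexOn ℝ (Set.Ici 0) Real.sinh := by
  refine strictConvexOn_of_deriv2_pos (convex_Ici 0) Real.continuous_sinh.continuousOn
    fun x hx => ?_
  rw [interior_Ici] at hx
  simpa using hx

/-- Strict convexity makes the slope `sinh s / s` of the chord from 0 increase. -/
lemma mul_sinh_lt_mul_sinh {s t : ℝ} (hs : 0 < s) (hst : s < t) :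
    t * Real.sinh s < s * Real.sinh t := by
  have ht := hs.trans hst
  have h := strictConvexOn_sinh.2 (Set.mem_Ici.2 le_rfl) (Set.mem_Ici.2 ht.le) ht.ne
    (show 0 < 1 - s / t by rw [sub_pos, div_lt_one ht]; exact hst) (show 0 < s / t by positivity)
    (by ring)
  simp only [smul_eq_mul, mul_zero, zero_add, Real.sinh_zero] at h
  rw [div_mul_cancel₀ _ ht.ne', div_mul_eq_mul_div, lt_div_iff₀ ht] at h
  linarith

/-- The right side factors as `sinh (t + s) sinh (t - s)`, and `u < sinh u` for `u > 0`. -/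
lemma sq_sub_sq_lt_sinh_sq_sub {s t : ℝ} (hs : 0 ≤ s) (hst : s < t) :
    t ^ 2 - s ^ 2 < Real.sinh t ^ 2 - Real.sinh s ^ 2 := by
  have h1 : Real.sinh t ^ 2 - Real.sinh s ^ 2 = Real.sinh (t + s) * Real.sinh (t - s) := by
    rw [Real.sinh_add, Real.sinh_sub]
    linear_combination (-Real.sinh t ^ 2) * Real.cosh_sq s + Real.sinh s ^ 2 * Real.cosh_sq t
  have h2 : t + s < Real.sinh (t + s) := Real.self_lt_sinh_iff.2 (by linarith)
  have h3 : t - s < Real.sinh (t - s) := Real.self_lt_sinh_iff.2 (by linarith)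
  rw [h1, show t ^ 2 - s ^ 2 = (t + s) * (t - s) by ring]
  exact mul_lt_mul'' h2 h3 (by linarith) (by linarith)

/-- The difference of the two sides is `[x² (sinh² t - sinh² s) - sin² x (t² - s²)] + [s² sinh² t -
t² sinh² s]`. Both brackets are nonnegative; the first is strict if `s = 0` (then `x ≠ 0`), the
second if `s > 0`. -/
lemma sin_sq_add_sinh_sq_mul_lt {x s t : ℝ} (hs : 0 ≤ s) (hst : s < t) (h : x ≠ 0 ∨ s ≠ 0) :
    (Real.sin x ^ 2 + Real.sinh s ^ 2) * (x ^ 2 + t ^ 2) <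
      (Real.sin x ^ 2 + Real.sinh t ^ 2) * (x ^ 2 + s ^ 2) := by
  have h1 := sq_sub_sq_lt_sinh_sq_sub hs hst
  have h2 : Real.sin x ^ 2 ≤ x ^ 2 := sq_le_sq.2 Real.abs_sin_le_abs
  have h3 : 0 ≤ t ^ 2 - s ^ 2 := by nlinarith
  have h4 : Real.sin x ^ 2 * (t ^ 2 - s ^ 2) ≤ x ^ 2 * (t ^ 2 - s ^ 2) :=
    mul_le_mul_of_nonneg_right h2 h3
  rcases hs.eq_or_lt with rfl | hs
  · have hx : 0 < x ^ 2 := by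
      have := h.resolve_right (by simp)
      positivity
    have h5 := mul_lt_mul_of_pos_left h1 hx
    simp only [Real.sinh_zero] at *
    nlinarith
  · have h5 := mul_le_mul_of_nonneg_left h1.le (sq_nonneg x)
    have h6 : (t * Real.sinh s) ^ 2 < (s * Real.sinh t) ^ 2 :=
      pow_lt_pow_left₀ (mul_sinh_lt_mul_sinh hs hst)
        (mul_nonneg (hs.trans hst).le (Real.sinh_nonneg_iff.2 hs.le)) two_ne_zero
    nlinarith

/-- This is the Hermite–Biehler inequality in disguise: `z - ia` and `z + ia` have the same real
part, and `|Im z - a| < Im z + a`. The removed singularity needs `πt < sinh πt` separately. -/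
lemma norm_sincPi_lt {z w : ℂ} (hre : z.re = w.re) (him : |z.im| < w.im) :
    ‖sincPi z‖ < ‖sincPi w‖ := by
  have hw0 : 0 < w.im := (abs_nonneg _).trans_lt him
  have hw : w ≠ 0 := fun h => by simp [h] at hw0
  have hpi := Real.pi_pos
  by_cases hz : z = 0
  · have hw' : w = I * w.im := by
      apply Complex.ext
      · rw [← hre, hz]; simp
      · simp
    rw [hw', norm_sincPi_I_mul hw0, hz, sincPi, if_pos rfl, norm_real,
      Real.norm_of_nonneg hpi.le, lt_div_iff₀ hw0]
    exact Real.self_lt_sinh_iff.2 (by positivity)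
  · refine lt_of_pow_lt_pow_left₀ 2 (norm_nonneg _) ?_
    have hzn : 0 < z.re ^ 2 + z.im ^ 2 := by
      have := normSq_pos.2 hz
      rw [normSq_apply] at this
      nlinarith
    rw [norm_sincPi_sq hz, norm_sincPi_sq hw, div_lt_div_iff₀ hzn (by positivity), ← hre,
      ← sq_abs (Real.sinh (Real.pi * z.im)), Real.abs_sinh, abs_mul, abs_of_pos hpi,
      ← sq_abs z.im]
    have hzn' : z.re ≠ 0 ∨ |z.im| ≠ 0 := by
      by_contra! h
      apply hz
      exact Complex.ext h.1 (abs_eq_zero.1 h.2)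
    have := sin_sq_add_sinh_sq_mul_lt (x := Real.pi * z.re) (s := Real.pi * |z.im|)
      (t := Real.pi * w.im) (by positivity) (by gcongr)
      (hzn'.imp (mul_ne_zero hpi.ne') (mul_ne_zero hpi.ne'))
    have hpi2 : 0 < Real.pi ^ 2 := by positivity
    refine lt_of_mul_lt_mul_left ?_ hpi2.le
    linarith

/-! ### The function `E_a` -/

/-- The normalizing constant of `E_a`. -/
noncomputable def cEa (a : ℝ) : ℝ := Real.sqrt (2 / Real.sinh (2 * Real.pi * a))

variable {a : ℝ}

lemma cEa_pos (ha : 0 < a) : 0 < cEa a := by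
  have : 0 < Real.sinh (2 * Real.pi * a) := Real.sinh_pos_iff.2 (by positivity)
  exact Real.sqrt_pos.2 (by positivity)

lemma cEa_sq (ha : 0 < a) : cEa a ^ 2 = 2 / Real.sinh (2 * Real.pi * a) := by
  have : 0 < Real.sinh (2 * Real.pi * a) := Real.sinh_pos_iff.2 (by positivity)
  exact Real.sq_sqrt (by positivity)

lemma Ea_eq (a : ℝ) (z : ℂ) : Ea a z = cEa a * sincPi (z + I * a) := rfl

lemma norm_Ea (ha : 0 < a) (z : ℂ) : ‖Ea a z‖ = cEa a * ‖sincPi (z + I * a)‖ := by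
  rw [Ea_eq, norm_mul, norm_real, Real.norm_of_nonneg (cEa_pos ha).le]

lemma starFn_Ea (a : ℝ) (z : ℂ) : starFn (Ea a) z = cEa a * sincPi (z - I * a) := by
  rw [starFn, Ea_eq, map_mul, conj_ofReal, conj_sincPi]
  simp [sub_eq_add_neg]

lemma differentiable_Ea (a : ℝ) : Differentiable ℂ (Ea a) := by
  have : Ea a = fun z => cEa a * sincPi (z + I * a) := rfl
  rw [this]
  exact (differentiable_sincPi.comp (differentiable_id.add_const _)).const_mul _

lemma isHermiteBiehler_Ea (ha : 0 < a) : IsHermiteBiehler (Ea a) := by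
  refine ⟨differentiable_Ea a, fun z hz => ?_⟩
  rw [starFn_Ea, norm_mul, norm_real, Real.norm_of_nonneg (cEa_pos ha).le, norm_Ea ha]
  refine mul_lt_mul_of_pos_left (norm_sincPi_lt (by simp) ?_) (cEa_pos ha)
  simp only [sub_im, mul_im, I_re, ofReal_im, mul_zero, I_im, ofReal_re, one_mul, zero_add, add_im]
  rw [abs_lt]
  constructor <;> linarith

lemma Ea_ne_zero (ha : 0 < a) {z : ℂ} (hz : z ∈ upperHP) : Ea a z ≠ 0 :=
  norm_pos_iff.1 ((norm_nonneg _).trans_lt ((isHermiteBiehler_Ea ha).2 z hz))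

lemma norm_Ea_le (ha : 0 < a) {z : ℂ} (hz : z ∈ upperHP) :
    ‖Ea a z‖ ≤ cEa a / a * Real.exp (Real.pi * a) * Real.exp (Real.pi * z.im) := by
  have hz' : 0 < z.im := hz
  have him : (z + I * a).im = z.im + a := by simp
  have hna : a ≤ ‖z + I * a‖ := by
    refine le_trans ?_ (abs_im_le_norm _)
    rw [him]
    exact (by linarith : a ≤ z.im + a).trans (le_abs_self _)
  have h0 : z + I * a ≠ 0 := norm_pos_iff.1 (ha.trans_le hna)
  have h := norm_sincPi_le h0
  rw [him, abs_of_pos (by linarith)] at h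
  have h2 : Real.exp (Real.pi * (z.im + a)) / ‖z + I * a‖ ≤
      Real.exp (Real.pi * (z.im + a)) / a := by
    gcongr
  rw [norm_Ea ha]
  calc _ ≤ cEa a * (Real.exp (Real.pi * (z.im + a)) / a) :=
        mul_le_mul_of_nonneg_left (h.trans h2) (cEa_pos ha).le
    _ = _ := by rw [mul_add, Real.exp_add]; ring

/-- From `cosh ≥ sinh` follows `sinh π(y + a) ≥ sinh (πa) exp (πy)`. The loss `1 / (y + a)` is
invisible to the mean type. -/
lemma norm_Ea_I_mul_ge (ha : 0 < a) {y : ℝ} (hy : 0 ≤ y) :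
    cEa a * Real.sinh (Real.pi * a) * Real.exp (Real.pi * y) / (y + a) ≤ ‖Ea a (I * y)‖ := by
  have h : I * (y : ℂ) + I * a = I * ((y + a : ℝ) : ℂ) := by push_cast; ring
  have hs : 0 < Real.sinh (Real.pi * a) := Real.sinh_pos_iff.2 (by positivity)
  rw [norm_Ea ha, h, norm_sincPi_I_mul (by linarith), mul_assoc, mul_div_assoc]
  have hc := cEa_pos ha
  gcongr
  rw [mul_add, Real.sinh_add, ← Real.cosh_add_sinh]
  have h1 : 0 ≤ Real.sinh (Real.pi * y) := Real.sinh_nonneg_iff.2 (by positivity)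
  have h2 := mul_le_mul_of_nonneg_left (Real.sinh_lt_cosh (Real.pi * a)).le h1
  linarith

lemma norm_cexp_pi_mul_I (z : ℂ) :
    ‖cexp (Real.pi * I * z)‖ = Real.exp (-(Real.pi * z.im)) := by
  rw [Complex.norm_exp]
  simp

lemma norm_Ea_mul_cexp_le (ha : 0 < a) {z : ℂ} (hz : z ∈ upperHP) :
    ‖Ea a z * cexp (Real.pi * I * z)‖ ≤ cEa a / a * Real.exp (Real.pi * a) := by
  rw [norm_mul, norm_cexp_pi_mul_I]
  refine (mul_le_mul_of_nonneg_right (norm_Ea_le ha hz) (Real.exp_pos _).le).trans ?_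
  rw [mul_assoc, ← Real.exp_add, add_neg_cancel, Real.exp_zero, mul_one]

lemma norm_cexp_pi_mul_I_le {z : ℂ} (hz : z ∈ upperHP) : ‖cexp (Real.pi * I * z)‖ ≤ 1 := by
  have hz' : 0 < z.im := hz
  rw [norm_cexp_pi_mul_I, Real.exp_le_one_iff]
  have := Real.pi_pos
  simp only [Left.neg_nonpos_iff]
  positivity

lemma differentiable_Ea_mul_cexp (a : ℝ) :
    Differentiable ℂ fun z => Ea a z * cexp (Real.pi * I * z) :=
  (differentiable_Ea a).mul (by fun_prop)

/-- The denominator `exp (iπz)` has modulus `exp (-π Im z)`, which cancels the growth of `E_a`. -/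
lemma isBoundedType_Ea (ha : 0 < a) : IsBoundedType (Ea a) :=
  ⟨(differentiable_Ea a).differentiableOn, fun z => Ea a z * cexp (Real.pi * I * z),
    fun z => cexp (Real.pi * I * z), (differentiable_Ea_mul_cexp a).differentiableOn,
    Differentiable.differentiableOn (by fun_prop), ⟨_, fun _ hz => norm_Ea_mul_cexp_le ha hz⟩,
    ⟨1, fun _ hz => norm_cexp_pi_mul_I_le hz⟩, ⟨I, by simp [upperHP], Complex.exp_ne_zero _⟩,
    fun _ _ => rfl⟩

lemma meanType_Ea (ha : 0 < a) : meanType (Ea a) = (Real.pi : EReal) := by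
  refine Tendsto.limsup_eq ?_
  set C := cEa a / a * Real.exp (Real.pi * a)
  set k := cEa a * Real.sinh (Real.pi * a)
  have hc := cEa_pos ha
  have hC : 0 < C := by positivity
  have hk : 0 < k := mul_pos hc (Real.sinh_pos_iff.2 (by positivity))
  have hreal : Tendsto (fun y : ℝ => y⁻¹ * Real.log ‖Ea a (I * y)‖) atTop (𝓝 Real.pi) := by
    have hlog : Tendsto (fun y : ℝ => y⁻¹ * Real.log y) atTop (𝓝 0) := by
      simpa [div_eq_inv_mul] using Real.isLittleO_log_id_atTop.tendsto_div_nhds_zero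
    have hlo : Tendsto (fun y : ℝ => Real.pi + (y⁻¹ * Real.log (k / 2) - y⁻¹ * Real.log y)) atTop
        (𝓝 Real.pi) := by
      simpa using ((tendsto_inv_atTop_zero.mul_const (Real.log (k / 2))).sub hlog).const_add Real.pi
    have hhi : Tendsto (fun y : ℝ => Real.pi + y⁻¹ * Real.log C) atTop (𝓝 Real.pi) := by
      simpa using (tendsto_inv_atTop_zero.mul_const (Real.log C)).const_add Real.pi
    refine tendsto_of_tendsto_of_tendsto_of_le_of_le' hlo hhi ?_ ?_
    · filter_upwards [eventually_ge_atTop a] with y hy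
      have hy0 : 0 < y := ha.trans_le hy
      -- For `y ≥ a` one has `y + a ≤ 2y`, hence `k / 2`.
      have h1 : k / 2 * Real.exp (Real.pi * y) / y ≤ ‖Ea a (I * y)‖ := by
        refine le_trans ?_ (norm_Ea_I_mul_ge ha hy0.le)
        rw [div_le_div_iff₀ hy0 (by linarith)]
        have : 0 < k * Real.exp (Real.pi * y) := by positivity
        nlinarith
      have h2 := Real.log_le_log (by positivity) h1
      rw [Real.log_div (by positivity) hy0.ne', Real.log_mul (by positivity) (Real.exp_pos _).ne',
        Real.log_exp] at h2
      calc _ = y⁻¹ * (Real.log (k / 2) + Real.pi * y - Real.log y) := by field_simp; ring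
        _ ≤ _ := mul_le_mul_of_nonneg_left h2 (by positivity)
    · filter_upwards [eventually_gt_atTop 0] with y hy
      have hmem : I * (y : ℂ) ∈ upperHP := by simpa [upperHP] using hy
      have h1 := norm_Ea_le ha hmem
      have h2 := Real.log_le_log (norm_pos_iff.2 (Ea_ne_zero ha hmem)) h1
      rw [Real.log_mul hC.ne' (Real.exp_pos _).ne', Real.log_exp] at h2
      simp only [mul_im, I_re, ofReal_im, mul_zero, I_im, ofReal_re, one_mul, zero_add] at h2
      calc _ ≤ y⁻¹ * (Real.log C + Real.pi * y) := mul_le_mul_of_nonneg_left h2 (by positivity)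
        _ = _ := by field_simp; ring
  refine ((continuous_coe_real_ereal.tendsto _).comp hreal).congr' ?_
  filter_upwards [eventually_gt_atTop 0] with y hy
  have hmem : I * (y : ℂ) ∈ upperHP := by simpa [upperHP] using hy
  rw [Function.comp_apply, EReal.coe_mul, ← ofReal_norm,
    ENNReal.log_ofReal_of_pos (norm_pos_iff.2 (Ea_ne_zero ha hmem))]

/-- On the imaginary axis conjugation changes the sign of the argument of the even function
`sincPi`. -/
lemma isRealEntire_Ea (a : ℝ) : IsRealEntire fun z => Ea a (I * z) := by
  refine ⟨(differentiable_Ea a).comp (by fun_prop), fun x => ?_⟩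
  rw [← conj_eq_iff_im]
  change conj (Ea a (I * x)) = Ea a (I * x)
  rw [Ea_eq, map_mul, conj_ofReal, conj_sincPi, ← sincPi_neg]
  simp [add_comm]

/-- The Poisson kernel `sinh 2πa / (cosh 2πa - cos 2πx)`. -/
noncomputable def poissonPi (a x : ℝ) : ℝ :=
  Real.sinh (2 * Real.pi * a) / (2 * (Real.sin (Real.pi * x) ^ 2 + Real.sinh (Real.pi * a) ^ 2))

lemma poissonPi_pos (ha : 0 < a) (x : ℝ) : 0 < poissonPi a x := by
  have h1 : 0 < Real.sinh (Real.pi * a) := Real.sinh_pos_iff.2 (by positivity)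
  have h2 : 0 < Real.sinh (2 * Real.pi * a) := Real.sinh_pos_iff.2 (by positivity)
  unfold poissonPi
  positivity

/-- The normalizing constant of `E_a` is chosen to produce the Poisson kernel, whose constant
Fourier coefficient is 1. -/
lemma norm_Ea_sq_inv (ha : 0 < a) (x : ℝ) :
    (‖Ea a x‖ ^ 2)⁻¹ = (x ^ 2 + a ^ 2) * poissonPi a x := by
  have h0 : (x : ℂ) + I * a ≠ 0 := fun h => by
    have := congrArg Complex.im h
    simp at this
    exact ha.ne' this
  have h1 : 0 < Real.sinh (Real.pi * a) := Real.sinh_pos_iff.2 (by positivity)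
  have h2 : 0 < Real.sinh (2 * Real.pi * a) := Real.sinh_pos_iff.2 (by positivity)
  rw [norm_Ea ha, mul_pow, cEa_sq ha, norm_sincPi_sq h0, poissonPi]
  simp only [add_re, ofReal_re, mul_re, I_re, zero_mul, I_im, ofReal_im, mul_zero, sub_zero,
    add_zero, add_im, mul_im, one_mul, zero_add]
  have h3 : 0 < Real.sin (Real.pi * x) ^ 2 + Real.sinh (Real.pi * a) ^ 2 := by positivity
  field_simp

lemma Ea_ofReal_ne_zero (ha : 0 < a) (x : ℝ) : Ea a x ≠ 0 := fun h => by
  have h1 := norm_Ea_sq_inv ha x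
  have h2 := poissonPi_pos ha x
  rw [h, norm_zero, zero_pow two_ne_zero, inv_zero] at h1
  have : 0 < (x ^ 2 + a ^ 2) * poissonPi a x := by positivity
  linarith

/-! ### Comparison of the two measures -/

lemma deBrangesMeasure_Ea (ha : 0 < a) : deBrangesMeasure (Ea a) =
    volume.withDensity fun x : ℝ => ENNReal.ofReal ((x ^ 2 + a ^ 2) * poissonPi a x) := by
  unfold deBrangesMeasure
  congr 1
  ext x
  have h : 0 < ‖Ea a x‖ := norm_pos_iff.2 (Ea_ofReal_ne_zero ha x)
  rw [← norm_Ea_sq_inv ha, ENNReal.ofReal_inv_of_pos (by positivity),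
    ENNReal.ofReal_pow (norm_nonneg _), ofReal_norm]

lemma poissonPi_le (ha : 0 < a) (x : ℝ) :
    poissonPi a x ≤ Real.sinh (2 * Real.pi * a) / (2 * Real.sinh (Real.pi * a) ^ 2) := by
  have h1 : 0 < Real.sinh (Real.pi * a) := Real.sinh_pos_iff.2 (by positivity)
  have h2 : 0 < Real.sinh (2 * Real.pi * a) := Real.sinh_pos_iff.2 (by positivity)
  unfold poissonPi
  gcongr
  exact le_add_of_nonneg_left (sq_nonneg _)

lemma le_poissonPi (ha : 0 < a) (x : ℝ) :
    Real.sinh (2 * Real.pi * a) / (2 * Real.cosh (Real.pi * a) ^ 2) ≤ poissonPi a x := by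
  have h1 : 0 < Real.sinh (Real.pi * a) := Real.sinh_pos_iff.2 (by positivity)
  have h2 : 0 < Real.sinh (2 * Real.pi * a) := Real.sinh_pos_iff.2 (by positivity)
  unfold poissonPi
  gcongr
  rw [Real.cosh_sq]
  linarith [Real.sin_sq_le_one (Real.pi * x)]

lemma withDensity_ofReal_le_smul {f g : ℝ → ℝ} {c : ℝ} (hc : 0 ≤ c) (hg : Measurable g)
    (h : ∀ x, f x ≤ c * g x) :
    (volume.withDensity fun x => ENNReal.ofReal (f x)) ≤
      ENNReal.ofReal c • volume.withDensity fun x => ENNReal.ofReal (g x) := by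
  rw [← withDensity_smul _ hg.ennreal_ofReal]
  refine withDensity_mono (Eventually.of_forall fun x => ?_)
  rw [Pi.smul_apply, smul_eq_mul, ← ENNReal.ofReal_mul hc]
  exact ENNReal.ofReal_le_ofReal (h x)

lemma continuous_poissonPi (ha : 0 < a) : Continuous (poissonPi a) := by
  unfold poissonPi
  refine continuous_const.div (by fun_prop) fun x => ?_
  have h1 : 0 < Real.sinh (Real.pi * a) := Real.sinh_pos_iff.2 (by positivity)
  positivity

/-- The densities differ by the factor `poissonPi`, which is bounded above and away from zero. -/
lemma memLp_deBrangesMeasure_Ea_iff (ha : 0 < a) (f : ℝ → ℂ) :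
    MemLp f 2 (deBrangesMeasure (Ea a)) ↔ MemLp f 2 (muA a) := by
  have h1 : 0 < Real.sinh (2 * Real.pi * a) := Real.sinh_pos_iff.2 (by positivity)
  have h2 : 0 < Real.cosh (Real.pi * a) := Real.cosh_pos _
  rw [deBrangesMeasure_Ea ha, muA]
  constructor
  · intro h
    refine h.of_measure_le_smul ENNReal.ofReal_ne_top (withDensity_ofReal_le_smul
      (c := (Real.sinh (2 * Real.pi * a) / (2 * Real.cosh (Real.pi * a) ^ 2))⁻¹) (by positivity)
      (Continuous.measurable (by have := continuous_poissonPi ha; fun_prop)) fun x => ?_)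
    rw [← div_eq_inv_mul, le_div_iff₀ (by positivity)]
    exact mul_le_mul_of_nonneg_left (le_poissonPi ha x) (by positivity)
  · intro h
    refine h.of_measure_le_smul ENNReal.ofReal_ne_top (withDensity_ofReal_le_smul
      (c := Real.sinh (2 * Real.pi * a) / (2 * Real.sinh (Real.pi * a) ^ 2)) (by positivity)
      (Continuous.measurable (by fun_prop)) fun x => ?_)
    rw [mul_comm]
    exact mul_le_mul_of_nonneg_right (poissonPi_le ha x) (by positivity)

lemma integrable_withDensity_ofReal_iff {E : Type*} [NormedAddCommGroup E] [NormedSpace ℝ E]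
    {w : ℝ → ℝ} (hw : Measurable w) (hw0 : ∀ x, 0 ≤ w x) (f : ℝ → E) :
    Integrable f (volume.withDensity fun x => ENNReal.ofReal (w x)) ↔
      Integrable fun x => w x • f x := by
  rw [integrable_withDensity_iff_integrable_smul' hw.ennreal_ofReal
    (Eventually.of_forall fun _ => ENNReal.ofReal_lt_top)]
  simp only [ENNReal.toReal_ofReal (hw0 _)]

lemma integral_withDensity_ofReal {E : Type*} [NormedAddCommGroup E] [NormedSpace ℝ E]
    {w : ℝ → ℝ} (hw : Measurable w) (hw0 : ∀ x, 0 ≤ w x) (f : ℝ → E) :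
    ∫ x, f x ∂(volume.withDensity fun x => ENNReal.ofReal (w x)) = ∫ x, w x • f x := by
  rw [integral_withDensity_eq_integral_toReal_smul hw.ennreal_ofReal
    (Eventually.of_forall fun _ => ENNReal.ofReal_lt_top)]
  simp only [ENNReal.toReal_ofReal (hw0 _)]

lemma integrable_mul_norm_sq (a : ℝ) {f : ℝ → ℂ} (h : MemLp f 2 (muA a)) :
    Integrable fun x : ℝ => (x ^ 2 + a ^ 2) * ‖f x‖ ^ 2 := by
  have h1 := (memLp_two_iff_integrable_sq_norm h.aestronglyMeasurable).1 h
  exact (integrable_withDensity_ofReal_iff (w := fun x => x ^ 2 + a ^ 2)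
    (Continuous.measurable (by fun_prop)) (fun x => by positivity) _).1 h1

lemma integrable_inv_sq_add_sq (ha : 0 < a) : Integrable fun x : ℝ => (x ^ 2 + a ^ 2)⁻¹ := by
  have h := (integrable_inv_one_add_sq.comp_div ha.ne').const_mul (a ^ 2)⁻¹
  refine h.congr (Eventually.of_forall fun x => ?_)
  simp only
  rw [← mul_inv]
  congr 1
  field_simp
  ring

/-- With `w = x² + a²`, one has `|f| ≤ w |f|² + 1 / w`, and both terms are integrable. This makes
the primitive argument of `exists_norm_le_exp_abs_im` available. -/
lemma integrable_of_memLp_muA (ha : 0 < a) {f : ℝ → ℂ} (hf : Continuous f)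
    (h : MemLp f 2 (muA a)) : Integrable f := by
  refine ((integrable_mul_norm_sq a h).add (integrable_inv_sq_add_sq ha)).mono
    hf.aestronglyMeasurable (Eventually.of_forall fun x => ?_)
  have hw : 0 < x ^ 2 + a ^ 2 := by positivity
  refine le_trans ?_ (le_abs_self _)
  simp only [Pi.add_apply]
  have h1 : 0 ≤ ((x ^ 2 + a ^ 2) * ‖f x‖ - 1) ^ 2 + (x ^ 2 + a ^ 2) * ‖f x‖ := by positivity
  have h2 : (x ^ 2 + a ^ 2) * ‖f x‖ ^ 2 + (x ^ 2 + a ^ 2)⁻¹ - ‖f x‖ =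
      (((x ^ 2 + a ^ 2) * ‖f x‖ - 1) ^ 2 + (x ^ 2 + a ^ 2) * ‖f x‖) / (x ^ 2 + a ^ 2) := by
    field_simp
    ring
  have h3 := div_nonneg h1 hw.le
  linarith

/-! ### The two spaces coincide -/

lemma norm_starFn (F : ℂ → ℂ) (z : ℂ) : ‖starFn F z‖ = ‖F (conj z)‖ := norm_conj _

/-- Integrability on the line removes the `ε` from the definition of exponential type and replaces
`|z|` by `|Im z|`. -/
lemma exists_norm_le_of_mem_expTypeSpace (ha : 0 < a) {F : ℂ → ℂ}
    (hF : F ∈ expTypeSpace 2 Real.pi (muA a)) :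
    ∃ M : ℝ, 0 ≤ M ∧ ∀ z, ‖F z‖ ≤ M * Real.exp (Real.pi * |z.im|) := by
  obtain ⟨⟨hd, hexp⟩, hL⟩ := hF
  have hray : ∀ c : ℂ, ‖c‖ = 1 → ∀ ε : ℝ, 0 < ε →
      ∀ᶠ y : ℝ in atTop, ‖F (c * y)‖ ≤ Real.exp ((Real.pi + ε) * y) := by
    intro c hc ε hε
    obtain ⟨C, -, hC⟩ := hexp (ε / 2) (half_pos hε)
    filter_upwards [eventually_const_mul_exp_le C hε, eventually_ge_atTop 0] with y hy hy0
    refine (hC _).trans ?_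
    rw [norm_mul, hc, one_mul, norm_real, Real.norm_of_nonneg hy0, add_mul, add_mul, Real.exp_add,
      Real.exp_add]
    calc _ = Real.exp (Real.pi * y) * (C * Real.exp (ε / 2 * y)) := by ring
      _ ≤ _ := by gcongr
  obtain ⟨C, -, hC⟩ := hexp 1 one_pos
  exact exists_norm_le_exp_abs_im hd ⟨_, C, hC⟩
    (integrable_of_memLp_muA ha (hd.continuous.comp continuous_ofReal) hL) Real.pi_pos.le
    (hray I norm_I) (hray (-I) (by simp))

lemma isBoundedType_div_Ea (ha : 0 < a) {F : ℂ → ℂ} (hF : Differentiable ℂ F) {M : ℝ}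
    (hM : ∀ z, ‖F z‖ ≤ M * Real.exp (Real.pi * |z.im|)) : IsBoundedType (F / Ea a) := by
  refine ⟨hF.differentiableOn.div (differentiable_Ea a).differentiableOn
    fun z hz => Ea_ne_zero ha hz, fun z => F z * cexp (Real.pi * I * z),
    fun z => Ea a z * cexp (Real.pi * I * z),
    (hF.mul (by fun_prop)).differentiableOn, (differentiable_Ea_mul_cexp a).differentiableOn,
    ⟨M, fun z hz => ?_⟩, ⟨_, fun _ hz => norm_Ea_mul_cexp_le ha hz⟩,
    ⟨I, by simp [upperHP], mul_ne_zero (Ea_ne_zero ha (by simp [upperHP])) (Complex.exp_ne_zero _)⟩,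
    fun z hz => ?_⟩
  · have hz' : 0 < z.im := hz
    have h := hM z
    rw [abs_of_pos hz'] at h
    rw [norm_mul, norm_cexp_pi_mul_I]
    refine (mul_le_mul_of_nonneg_right h (Real.exp_pos _).le).trans ?_
    rw [mul_assoc, ← Real.exp_add, add_neg_cancel, Real.exp_zero, mul_one]
  · have := Ea_ne_zero ha hz
    rw [Pi.div_apply]
    field_simp

/-- Along the imaginary axis the exponentials cancel and the quotient is `O(y + a)`. -/
lemma meanType_div_Ea_nonpos (ha : 0 < a) {F : ℂ → ℂ} {M : ℝ} (hM0 : 0 ≤ M)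
    (hM : ∀ z, ‖F z‖ ≤ M * Real.exp (Real.pi * |z.im|)) : meanType (F / Ea a) ≤ 0 := by
  rw [meanType_nonpos_iff]
  intro ε hε
  set k := cEa a * Real.sinh (Real.pi * a)
  have hk : 0 < k := mul_pos (cEa_pos ha) (Real.sinh_pos_iff.2 (by positivity))
  filter_upwards [eventually_const_mul_exp_le (M / k * (2 / ε + a)) hε, eventually_ge_atTop 0]
    with y hy hy0
  have h1 := hM (I * y)
  have h2 := norm_Ea_I_mul_ge ha hy0
  have e : (I * (y : ℂ)).im = y := by simp
  rw [e, abs_of_nonneg hy0] at h1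
  have h3 : y + a ≤ (2 / ε + a) * Real.exp (ε / 2 * y) := by
    have h4 := Real.add_one_le_exp (ε / 2 * y)
    have h5 : (1 : ℝ) ≤ Real.exp (ε / 2 * y) := Real.one_le_exp (by positivity)
    have h6 : y ≤ 2 / ε * Real.exp (ε / 2 * y) := by
      calc y = 2 / ε * (ε / 2 * y) := by field_simp
        _ ≤ _ := by gcongr; linarith
    nlinarith
  rw [Pi.div_apply, norm_div]
  calc ‖F (I * y)‖ / ‖Ea a (I * y)‖
      ≤ M * Real.exp (Real.pi * y) / (k * Real.exp (Real.pi * y) / (y + a)) :=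
        div_le_div₀ (by positivity) h1 (by positivity) h2
    _ = M / k * (y + a) := by field_simp
    _ ≤ M / k * ((2 / ε + a) * Real.exp (ε / 2 * y)) := by gcongr
    _ = M / k * (2 / ε + a) * Real.exp (ε / 2 * y) := by ring
    _ ≤ _ := hy

lemma expTypeSpace_le_deBrangesSpace (ha : 0 < a) :
    expTypeSpace 2 Real.pi (muA a) ≤ deBrangesSpace (Ea a) := by
  intro F hF
  obtain ⟨M, hM0, hM⟩ := exists_norm_le_of_mem_expTypeSpace ha hF
  obtain ⟨⟨hd, -⟩, hL⟩ := hF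
  have hM' : ∀ z, ‖starFn F z‖ ≤ M * Real.exp (Real.pi * |z.im|) := fun z => by
    rw [norm_starFn]
    simpa using hM (conj z)
  exact ⟨hd, (memLp_deBrangesMeasure_Ea_iff ha _).2 hL,
    ⟨isBoundedType_div_Ea ha hd hM, meanType_div_Ea_nonpos ha hM0 hM⟩,
    ⟨isBoundedType_div_Ea ha (differentiable_starFn hd) hM', meanType_div_Ea_nonpos ha hM0 hM'⟩⟩

lemma isBoundedType_of_div_Ea (ha : 0 < a) {F : ℂ → ℂ} (hF : Differentiable ℂ F)
    (h : IsBoundedType (F / Ea a)) : IsBoundedType F := by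
  obtain ⟨-, P, Q, hP, hQ, ⟨M, hM⟩, ⟨N, hN⟩, ⟨z₁, hz₁, hne⟩, he⟩ := h
  refine ⟨hF.differentiableOn, fun z => P z * (Ea a z * cexp (Real.pi * I * z)),
    fun z => Q z * cexp (Real.pi * I * z),
    hP.mul (differentiable_Ea_mul_cexp a).differentiableOn,
    hQ.mul (Differentiable.differentiableOn (by fun_prop)),
    ⟨M * (cEa a / a * Real.exp (Real.pi * a)), fun z hz => ?_⟩, ⟨N * 1, fun z hz => ?_⟩,
    ⟨z₁, hz₁, mul_ne_zero hne (Complex.exp_ne_zero _)⟩, fun z hz => ?_⟩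
  · rw [norm_mul]
    exact mul_le_mul (hM z hz) (norm_Ea_mul_cexp_le ha hz) (norm_nonneg _)
      ((norm_nonneg _).trans (hM z hz))
  · rw [norm_mul]
    exact mul_le_mul (hN z hz) (norm_cexp_pi_mul_I_le hz) (norm_nonneg _)
      ((norm_nonneg _).trans (hN z hz))
  · have := Ea_ne_zero ha hz
    simp only [← he z hz, Pi.div_apply]
    field_simp

lemma eventually_norm_le_of_meanType_div_Ea (ha : 0 < a) {F : ℂ → ℂ}
    (h : meanType (F / Ea a) ≤ 0) (ε : ℝ) (hε : 0 < ε) :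
    ∀ᶠ y : ℝ in atTop, ‖F (I * y)‖ ≤ Real.exp ((Real.pi + ε) * y) := by
  rw [meanType_nonpos_iff] at h
  filter_upwards [h _ (half_pos hε), eventually_const_mul_exp_le
    (cEa a / a * Real.exp (Real.pi * a)) hε, eventually_gt_atTop 0] with y h1 h2 hy
  have hmem : I * (y : ℂ) ∈ upperHP := by simpa [upperHP] using hy
  have h3 := norm_Ea_le ha hmem
  have e : (I * (y : ℂ)).im = y := by simp
  rw [e] at h3
  rw [Pi.div_apply, norm_div, div_le_iff₀ (norm_pos_iff.2 (Ea_ne_zero ha hmem))] at h1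
  calc _ ≤ _ := h1
    _ ≤ Real.exp (ε / 2 * y) *
        (cEa a / a * Real.exp (Real.pi * a) * Real.exp (Real.pi * y)) := by gcongr
    _ = cEa a / a * Real.exp (Real.pi * a) * Real.exp (ε / 2 * y) * Real.exp (Real.pi * y) := by
        ring
    _ ≤ Real.exp (ε * y) * Real.exp (Real.pi * y) := by gcongr
    _ = _ := by rw [← Real.exp_add]; congr 1; ring

/-- Krein's theorem supplies some finite type. The mean types of `F / E_a` and `F^* / E_a` reduce it
to `π` on the upper and lower imaginary half axes, and integrability on the line spreads this bound
over the plane. -/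
lemma deBrangesSpace_le_expTypeSpace (ha : 0 < a) :
    deBrangesSpace (Ea a) ≤ expTypeSpace 2 Real.pi (muA a) := by
  rintro F ⟨hd, hL, ⟨hb, hm⟩, ⟨hb', hm'⟩⟩
  have hL' := (memLp_deBrangesMeasure_Ea_iff ha _).1 hL
  refine ⟨⟨hd, fun ε hε => ?_⟩, hL'⟩
  obtain ⟨M, hM0, hM⟩ := exists_norm_le_exp_abs_im hd
    (exists_norm_le_exp_of_isBoundedType hd (isBoundedType_of_div_Ea ha hd hb)
      (isBoundedType_of_div_Ea ha (differentiable_starFn hd) hb'))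
    (integrable_of_memLp_muA ha (hd.continuous.comp continuous_ofReal) hL') Real.pi_pos.le
    (eventually_norm_le_of_meanType_div_Ea ha hm) (fun δ hδ => by
      filter_upwards [eventually_norm_le_of_meanType_div_Ea ha hm' δ hδ] with y hy
      rw [norm_starFn] at hy
      simpa using hy)
  refine ⟨M + 1, by positivity, fun z => (hM z).trans ?_⟩
  have hpi := Real.pi_pos
  gcongr
  · linarith
  · linarith
  · exact abs_im_le_norm z

lemma expTypeSpace_eq_deBrangesSpace (ha : 0 < a) :
    expTypeSpace 2 Real.pi (muA a) = deBrangesSpace (Ea a) :=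
  le_antisymm (expTypeSpace_le_deBrangesSpace ha) (deBrangesSpace_le_expTypeSpace ha)

/-! ### The companion function does not belong to the space -/

/-- On the real line `E_a^*` is the conjugate of `E_a`, so `B_a = -Im E_a` there. -/
lemma sq_add_sq_mul_norm_companionB_sq (ha : 0 < a) (x : ℝ) :
    (x ^ 2 + a ^ 2) * ‖companionB (Ea a) x‖ ^ 2 = cEa a ^ 2 *
      ((Real.cos (Real.pi * x) * Real.sinh (Real.pi * a) * x -
        a * (Real.sin (Real.pi * x) * Real.cosh (Real.pi * a))) ^ 2 / (x ^ 2 + a ^ 2)) := by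
  have hw : 0 < x ^ 2 + a ^ 2 := by positivity
  have h0 : (x : ℂ) + I * a ≠ 0 := fun h => by
    have := congrArg Complex.im h
    simp at this
    exact ha.ne' this
  have hB : companionB (Ea a) x = ((-(cEa a * (sincPi (x + I * a)).im) : ℝ) : ℂ) := by
    have h1 : starFn (Ea a) x = conj (Ea a x) := by rw [starFn, conj_ofReal]
    rw [companionB, h1, Complex.sub_conj, Ea_eq, im_ofReal_mul]
    push_cast
    linear_combination ((cEa a : ℂ) * ((sincPi (x + I * a)).im : ℂ)) * I_mul_I
  have him : (sincPi (x + I * a)).im = (Real.cos (Real.pi * x) * Real.sinh (Real.pi * a) * x -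
        a * (Real.sin (Real.pi * x) * Real.cosh (Real.pi * a))) / (x ^ 2 + a ^ 2) := by
    have h2 : (Real.pi : ℂ) * (x + I * a) =
        ((Real.pi * x : ℝ) : ℂ) + ((Real.pi * a : ℝ) : ℂ) * I := by push_cast; ring
    have hn : normSq ((x : ℂ) + I * a) = x ^ 2 + a ^ 2 := by
      rw [normSq_apply]; simp; ring
    rw [sincPi, if_neg h0, h2, Complex.sin_add_mul_I, ← ofReal_sin, ← ofReal_cos, ← ofReal_sinh,
      ← ofReal_cosh, div_im, hn, ← sub_div]
    congr 1
    simp only [add_re, add_im, mul_re, mul_im, ofReal_re, ofReal_im, I_re, I_im]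
    ring
  rw [hB, norm_real, Real.norm_eq_abs, sq_abs, him]
  field_simp

lemma companionB_Ea_notMem (ha : 0 < a) : companionB (Ea a) ∉ deBrangesSpace (Ea a) := by
  rintro ⟨-, hL, -⟩
  have h1 := integrable_mul_norm_sq a ((memLp_deBrangesMeasure_Ea_iff ha _).1 hL)
  simp only [sq_add_sq_mul_norm_companionB_sq ha] at h1
  set S := Real.sinh (Real.pi * a)
  set T := Real.cosh (Real.pi * a)
  have hS : 0 < S := Real.sinh_pos_iff.2 (by positivity)
  have hc := cEa_pos ha
  have h2 : Integrable fun x : ℝ => (Real.cos (Real.pi * x) * S * x -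
      a * (Real.sin (Real.pi * x) * T)) ^ 2 / (x ^ 2 + a ^ 2) := by
    refine (h1.const_mul (cEa a ^ 2)⁻¹).congr (Eventually.of_forall fun x => ?_)
    simp only
    rw [inv_mul_cancel_left₀ (by positivity)]
  have hcos : Integrable fun x : ℝ => Real.cos (Real.pi * x) ^ 2 := by
    have h3 : Integrable fun x : ℝ => S ^ 2 * Real.cos (Real.pi * x) ^ 2 := by
      refine ((h2.const_mul 2).add ((integrable_inv_sq_add_sq ha).const_mul
        (2 * a ^ 2 * T ^ 2 + a ^ 2 * S ^ 2))).mono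
        (Continuous.aestronglyMeasurable (by fun_prop)) (Eventually.of_forall fun x => ?_)
      have hw : 0 < x ^ 2 + a ^ 2 := by positivity
      refine le_trans ?_ (le_abs_self _)
      rw [Real.norm_of_nonneg (by positivity), Pi.add_apply]
      set u := Real.sin (Real.pi * x)
      set v := Real.cos (Real.pi * x)
      have hu : 2 * a ^ 2 * T ^ 2 * u ^ 2 ≤ 2 * a ^ 2 * T ^ 2 * 1 :=
        mul_le_mul_of_nonneg_left (Real.sin_sq_le_one _) (by positivity)
      have hv : a ^ 2 * S ^ 2 * v ^ 2 ≤ a ^ 2 * S ^ 2 * 1 :=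
        mul_le_mul_of_nonneg_left (Real.cos_sq_le_one _) (by positivity)
      rw [← div_eq_mul_inv, ← mul_div_assoc, ← add_div, le_div_iff₀ hw]
      -- With `A = vSx` and `B = auT`, this is `A² ≤ 2 (A - B)² + 2 B²`, the difference being `(A -
      -- 2B)²`. Replacing `x²` by `x² + a²` costs the term `a² S²`.
      nlinarith [sq_nonneg (v * S * x - 2 * (a * (u * T)))]
    refine (h3.const_mul (S ^ 2)⁻¹).congr (Eventually.of_forall fun x => ?_)
    simp only
    rw [inv_mul_cancel_left₀ (by positivity)]
  -- A translate by `1/2` turns `cos²` into `sin²`; their sum 1 would then be integrable on the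
  -- line.
  have hsin : Integrable fun x : ℝ => Real.sin (Real.pi * x) ^ 2 := by
    refine (hcos.comp_sub_right (1 / 2)).congr (Eventually.of_forall fun x => ?_)
    simp only
    rw [mul_sub, mul_one_div, Real.cos_sub_pi_div_two]
  have hone : Integrable fun _ : ℝ => (1 : ℝ) :=
    (hsin.add hcos).congr (Eventually.of_forall fun x => Real.sin_sq_add_cos_sq _)
  rw [integrable_const_iff] at hone
  simp [isFiniteMeasure_iff] at hone

lemma standingConditions_Ea (ha : 0 < a) : StandingConditions (Ea a) Real.pi :=
  ⟨isBoundedType_Ea ha, meanType_Ea ha, Ea_ofReal_ne_zero ha, isRealEntire_Ea a,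
    companionB_Ea_notMem ha⟩

/-! ### Equality of the scalar products -/

/-- The analytic part `∑_{n ≥ 1} r ^ n exp (2πinz)`, `r = exp (-2πa)`, of the Poisson kernel. -/
noncomputable def poissonPart (a : ℝ) (z : ℂ) : ℂ :=
  Real.exp (-(2 * Real.pi * a)) * cexp (2 * Real.pi * I * z) /
    (1 - Real.exp (-(2 * Real.pi * a)) * cexp (2 * Real.pi * I * z))

lemma norm_exp_mul_cexp (a : ℝ) (z : ℂ) :
    ‖(Real.exp (-(2 * Real.pi * a)) : ℂ) * cexp (2 * Real.pi * I * z)‖ =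
      Real.exp (-(2 * Real.pi * a)) * Real.exp (-(2 * Real.pi * z.im)) := by
  rw [norm_mul, norm_real, Real.norm_of_nonneg (Real.exp_pos _).le, Complex.norm_exp]
  congr 2
  simp

lemma one_sub_exp_le_norm (a : ℝ) {z : ℂ} (hz : 0 ≤ z.im) :
    1 - Real.exp (-(2 * Real.pi * a)) ≤
      ‖1 - (Real.exp (-(2 * Real.pi * a)) : ℂ) * cexp (2 * Real.pi * I * z)‖ := by
  have h := norm_sub_norm_le (1 : ℂ)
    ((Real.exp (-(2 * Real.pi * a)) : ℂ) * cexp (2 * Real.pi * I * z))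
  rw [norm_one, norm_exp_mul_cexp] at h
  have hpi := Real.pi_pos
  have h1 : Real.exp (-(2 * Real.pi * z.im)) ≤ 1 := by
    rw [Real.exp_le_one_iff, Left.neg_nonpos_iff]; positivity
  have h2 := mul_le_of_le_one_right (Real.exp_pos (-(2 * Real.pi * a))).le h1
  linarith

lemma one_sub_exp_pos (ha : 0 < a) : 0 < 1 - Real.exp (-(2 * Real.pi * a)) := by
  have hpi := Real.pi_pos
  rw [sub_pos, Real.exp_lt_one_iff, Left.neg_neg_iff]
  positivity

lemma one_sub_exp_mul_cexp_ne_zero (ha : 0 < a) {z : ℂ} (hz : 0 ≤ z.im) :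
    1 - (Real.exp (-(2 * Real.pi * a)) : ℂ) * cexp (2 * Real.pi * I * z) ≠ 0 :=
  norm_pos_iff.1 ((one_sub_exp_pos ha).trans_le (one_sub_exp_le_norm a hz))

lemma norm_poissonPart_le (ha : 0 < a) {z : ℂ} (hz : 0 ≤ z.im) :
    ‖poissonPart a z‖ ≤ Real.exp (-(2 * Real.pi * z.im)) / (1 - Real.exp (-(2 * Real.pi * a))) := by
  rw [poissonPart, norm_div, norm_exp_mul_cexp]
  refine div_le_div₀ (Real.exp_pos _).le ?_ (one_sub_exp_pos ha) (one_sub_exp_le_norm a hz)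
  exact mul_le_of_le_one_left (Real.exp_pos _).le (by linarith [one_sub_exp_pos ha])

lemma differentiableAt_poissonPart (ha : 0 < a) {z : ℂ} (hz : 0 ≤ z.im) :
    DifferentiableAt ℂ (poissonPart a) z := by
  have := one_sub_exp_mul_cexp_ne_zero ha hz
  unfold poissonPart
  fun_prop (disch := assumption)

/-- With `q = exp (2πix)` and `r = exp (-2πa)`, the denominator factors through `(1 - rq)(1 - r/q)`,
and the identity is a partial fraction decomposition. -/
lemma poissonPi_eq (ha : 0 < a) (x : ℝ) :
    (poissonPi a x : ℂ) = 1 + poissonPart a x + poissonPart a (-x) := by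
  have h1 := one_sub_exp_mul_cexp_ne_zero ha (z := x) (by simp)
  have h2 := one_sub_exp_mul_cexp_ne_zero ha (z := -x) (by simp)
  have hq : cexp (2 * Real.pi * I * -x) = (cexp (2 * Real.pi * I * x))⁻¹ := by
    rw [← Complex.exp_neg]; congr 1; ring
  have hr : (Real.exp (2 * Real.pi * a) : ℂ) = (Real.exp (-(2 * Real.pi * a)) : ℂ)⁻¹ := by
    rw [Real.exp_neg]; push_cast; rw [inv_inv]
  have hsin : ((Real.sin (Real.pi * x) ^ 2 : ℝ) : ℂ) =
      (2 - cexp (2 * Real.pi * I * x) - (cexp (2 * Real.pi * I * x))⁻¹) / 4 := by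
    have h3 : Real.sin (Real.pi * x) ^ 2 = (1 - Real.cos (2 * (Real.pi * x))) / 2 := by
      rw [Real.cos_two_mul, Real.cos_sq']; ring
    rw [h3, ← Complex.exp_neg]
    push_cast
    rw [Complex.cos]
    rw [show 2 * (Real.pi * (x : ℂ)) * I = 2 * Real.pi * I * x by ring,
      show -(2 * (Real.pi * (x : ℂ))) * I = -(2 * Real.pi * I * x) by ring]
    ring
  have hsinh : ((Real.sinh (Real.pi * a) ^ 2 : ℝ) : ℂ) =
      ((Real.exp (-(2 * Real.pi * a)) : ℂ) + (Real.exp (-(2 * Real.pi * a)) : ℂ)⁻¹ - 2) / 4 := by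
    rw [← hr]
    have h3 : Real.sinh (Real.pi * a) ^ 2 =
        (Real.exp (-(2 * Real.pi * a)) + Real.exp (2 * Real.pi * a) - 2) / 4 := by
      rw [Real.sinh_eq, div_pow, sub_sq, mul_assoc, ← Real.exp_add, ← Real.exp_nat_mul,
        ← Real.exp_nat_mul]
      rw [show ((2 : ℕ) : ℝ) * (Real.pi * a) = 2 * Real.pi * a by push_cast; ring,
        show ((2 : ℕ) : ℝ) * -(Real.pi * a) = -(2 * Real.pi * a) by push_cast; ring]
      simp
      ring
    rw [h3]
    push_cast
    ring
  have hsinh2 : (Real.sinh (2 * Real.pi * a) : ℂ) =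
      ((Real.exp (-(2 * Real.pi * a)) : ℂ)⁻¹ - (Real.exp (-(2 * Real.pi * a)) : ℂ)) / 2 := by
    rw [← hr, Real.sinh_eq]
    push_cast
    ring
  have hq0 : cexp (2 * Real.pi * I * x) ≠ 0 := Complex.exp_ne_zero _
  have hr0 : (Real.exp (-(2 * Real.pi * a)) : ℂ) ≠ 0 := by exact_mod_cast (Real.exp_pos _).ne'
  rw [poissonPi, ofReal_div, ofReal_mul, ofReal_add, hsin, hsinh, hsinh2, poissonPart, poissonPart,
    hq]
  rw [hq] at h2
  generalize cexp (2 * Real.pi * I * x) = q at *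
  generalize (Real.exp (-(2 * Real.pi * a)) : ℂ) = r at *
  have h3 : (2 - q - q⁻¹) / 4 + (r + r⁻¹ - 2) / 4 = (1 - r * q) * (1 - r * q⁻¹) / (4 * r) := by
    field_simp
    ring
  rw [h3]
  have h4 : q - r ≠ 0 := by
    intro h
    apply h2
    rw [← sub_eq_zero.1 h, mul_inv_cancel₀ hq0, sub_self]
  push_cast
  field_simp
  ring

/-- The decay `exp (-2π Im z)` of `poissonPart` exactly offsets the growth of `H`, so the product is
bounded in the upper half plane. -/
lemma integral_mul_poissonPart (ha : 0 < a) {H : ℂ → ℂ} {M : ℝ} (hH : Differentiable ℂ H)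
    (hM : ∀ z, ‖H z‖ ≤ M * Real.exp (2 * Real.pi * |z.im|))
    (hint : Integrable fun x : ℝ => H x) :
    (Integrable fun x : ℝ => H x * poissonPart a x) ∧
      ∫ x : ℝ, H x * poissonPart a x = 0 := by
  have hd : ∀ z : ℂ, 0 ≤ z.im → DifferentiableAt ℂ (fun z => H z * poissonPart a z) z :=
    fun z hz => (hH z).mul (differentiableAt_poissonPart ha hz)
  have h1 := one_sub_exp_pos ha
  have hi : Integrable fun x : ℝ => H x * poissonPart a x := by
    refine (hint.norm.mul_const (1 - Real.exp (-(2 * Real.pi * a)))⁻¹).mono'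
      (Continuous.aestronglyMeasurable (continuous_iff_continuousAt.2 fun x =>
        (hd x (by simp)).continuousAt.comp (f := fun x : ℝ => (x : ℂ))
          continuous_ofReal.continuousAt)) (Eventually.of_forall fun x => ?_)
    rw [norm_mul]
    refine mul_le_mul_of_nonneg_left ?_ (norm_nonneg _)
    refine (norm_poissonPart_le ha (z := x) (by simp)).trans (le_of_eq ?_)
    simp
  refine ⟨hi, integral_eq_zero_of_bounded_upperHP (K := fun z => H z * poissonPart a z)
    (M := M / (1 - Real.exp (-(2 * Real.pi * a)))) hd (fun z hz => ?_) hi⟩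
  have h2 := hM z
  rw [abs_of_nonneg hz] at h2
  rw [norm_mul]
  calc _ ≤ M * Real.exp (2 * Real.pi * z.im) *
        (Real.exp (-(2 * Real.pi * z.im)) / (1 - Real.exp (-(2 * Real.pi * a)))) :=
        mul_le_mul h2 (norm_poissonPart_le ha hz) (norm_nonneg _) ((norm_nonneg _).trans h2)
    _ = M * (Real.exp (2 * Real.pi * z.im) * Real.exp (-(2 * Real.pi * z.im))) /
        (1 - Real.exp (-(2 * Real.pi * a))) := by ring
    _ = _ := by rw [← Real.exp_add, add_neg_cancel, Real.exp_zero, mul_one]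

/-- Functions of exponential type `2π` do not see the nonconstant part of the Poisson kernel. -/
lemma integral_poissonPi_smul (ha : 0 < a) {H : ℂ → ℂ} {M : ℝ} (hH : Differentiable ℂ H)
    (hM : ∀ z, ‖H z‖ ≤ M * Real.exp (2 * Real.pi * |z.im|))
    (hint : Integrable fun x : ℝ => H x) :
    ∫ x : ℝ, poissonPi a x • H x = ∫ x : ℝ, H x := by
  obtain ⟨hi, h0⟩ := integral_mul_poissonPart ha hH hM hint
  have hint' : Integrable fun x : ℝ => H (-(x : ℂ)) := by
    simpa using hint.comp_neg
  -- The term `p(-x)` continues to the lower half plane; the reflection `z ↦ -z` reduces it to the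
  -- previous case.
  obtain ⟨hi', h0'⟩ := integral_mul_poissonPart ha (H := fun z => H (-z)) (by fun_prop)
    (fun z => by simpa using hM (-z)) hint'
  have hi'' : Integrable fun x : ℝ => H x * poissonPart a (-x) := by
    simpa using hi'.comp_neg
  have h0'' : ∫ x : ℝ, H x * poissonPart a (-x) = 0 := by
    rw [← h0', ← integral_neg_eq_self]
    simp
  have e : ∀ x : ℝ, poissonPi a x • H x =
      H x + H x * poissonPart a x + H x * poissonPart a (-x) := fun x => by
    rw [real_smul, poissonPi_eq ha]; ring
  simp only [e]
  have hadd : Integrable fun x : ℝ => H x + H x * poissonPart a x := hint.add hi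
  rw [integral_add hadd hi'', integral_add hint hi, h0, h0'', add_zero, add_zero]

lemma sq_add_sq_le_mul_exp (a : ℝ) {t ε : ℝ} (ht : 0 ≤ t) (hε : 0 < ε) :
    t ^ 2 + a ^ 2 ≤ (2 / ε ^ 2 + a ^ 2) * Real.exp (ε * t) := by
  have h1 := Real.quadratic_le_exp_of_nonneg (show 0 ≤ ε * t by positivity)
  have h2 : (1 : ℝ) ≤ Real.exp (ε * t) := Real.one_le_exp (by positivity)
  have h3 : t ^ 2 ≤ 2 / ε ^ 2 * Real.exp (ε * t) := by
    have h4 : 0 ≤ ε * t := by positivity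
    calc t ^ 2 = 2 / ε ^ 2 * ((ε * t) ^ 2 / 2) := by field_simp
      _ ≤ _ := by gcongr; linarith
  have h4 := mul_le_mul_of_nonneg_left h2 (sq_nonneg a)
  linarith

lemma scalarProd_eq (ha : 0 < a) {F G : ℂ → ℂ} (hF : F ∈ expTypeSpace 2 Real.pi (muA a))
    (hG : G ∈ expTypeSpace 2 Real.pi (muA a)) :
    scalarProd (muA a) F G = scalarProd (deBrangesMeasure (Ea a)) F G := by
  obtain ⟨M, hM0, hM⟩ := exists_norm_le_of_mem_expTypeSpace ha hF
  obtain ⟨N, hN0, hN⟩ := exists_norm_le_of_mem_expTypeSpace ha hG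
  obtain ⟨⟨hFd, -⟩, hFL⟩ := hF
  obtain ⟨⟨hGd, -⟩, hGL⟩ := hG
  have hGs := differentiable_starFn hGd
  set H : ℂ → ℂ := fun z => (z ^ 2 + (a : ℂ) ^ 2) * (F z * starFn G z) with hHdef
  have hH : Differentiable ℂ H :=
    (by fun_prop : Differentiable ℂ fun z : ℂ => z ^ 2 + (a : ℂ) ^ 2).mul (hFd.mul hGs)
  have hHreal : ∀ x : ℝ, H x = (x ^ 2 + a ^ 2) • (F x * starFn G x) := fun x => by
    rw [real_smul, hHdef]; push_cast; rfl
  have hHn : ∀ z, ‖H z‖ ≤ M * N * ((‖z‖ ^ 2 + a ^ 2) * Real.exp (2 * Real.pi * |z.im|)) := by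
    intro z
    have h1 : ‖z ^ 2 + (a : ℂ) ^ 2‖ ≤ ‖z‖ ^ 2 + a ^ 2 := by
      refine (norm_add_le _ _).trans (le_of_eq ?_)
      rw [norm_pow, norm_pow, norm_real, Real.norm_of_nonneg ha.le]
    have h2 : ‖starFn G z‖ ≤ N * Real.exp (Real.pi * |z.im|) := by
      rw [norm_starFn]; simpa using hN (conj z)
    rw [hHdef, norm_mul, norm_mul]
    calc _ ≤ (‖z‖ ^ 2 + a ^ 2) *
          (M * Real.exp (Real.pi * |z.im|) * (N * Real.exp (Real.pi * |z.im|))) :=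
          mul_le_mul h1 (mul_le_mul (hM z) h2 (norm_nonneg _) (by positivity)) (by positivity)
            (by positivity)
      _ = M * N * ((‖z‖ ^ 2 + a ^ 2) *
          (Real.exp (Real.pi * |z.im|) * Real.exp (Real.pi * |z.im|))) := by ring
      _ = _ := by rw [← Real.exp_add]; congr 4; ring
  have hint : Integrable fun x : ℝ => H x := by
    refine ((integrable_mul_norm_sq a hFL).add (integrable_mul_norm_sq a hGL)).mono'
      (hH.continuous.comp continuous_ofReal).aestronglyMeasurable
      (Eventually.of_forall fun x => ?_)
    have hw : 0 < x ^ 2 + a ^ 2 := by positivity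
    rw [hHreal, norm_smul, Real.norm_of_nonneg hw.le, norm_mul, norm_starFn, conj_ofReal,
      Pi.add_apply, ← mul_add]
    refine mul_le_mul_of_nonneg_left ?_ hw.le
    nlinarith [sq_nonneg (‖F x‖ - ‖G x‖), sq_nonneg (‖F x‖), sq_nonneg (‖G x‖)]
  have hray : ∀ c : ℂ, ‖c‖ = 1 → ∀ ε : ℝ, 0 < ε →
      ∀ᶠ y : ℝ in atTop, ‖H (c * y)‖ ≤ Real.exp ((2 * Real.pi + ε) * y) := by
    intro c hc ε hε
    -- Half of `ε` absorbs the quadratic weight, the other half the constants.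
    filter_upwards [eventually_const_mul_exp_le (M * N * (2 / (ε / 2) ^ 2 + a ^ 2)) hε,
      eventually_ge_atTop 0] with y hy hy0
    have hn : ‖c * (y : ℂ)‖ = y := by
      rw [norm_mul, hc, one_mul, norm_real, Real.norm_of_nonneg hy0]
    have him : |(c * (y : ℂ)).im| ≤ y := (abs_im_le_norm _).trans hn.le
    have h1 := sq_add_sq_le_mul_exp a hy0 (half_pos hε)
    have hpi := Real.pi_pos
    calc _ ≤ _ := hHn _
      _ ≤ M * N * ((2 / (ε / 2) ^ 2 + a ^ 2) * Real.exp (ε / 2 * y) *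
          Real.exp (2 * Real.pi * y)) := by
          rw [hn]; gcongr
      _ = M * N * (2 / (ε / 2) ^ 2 + a ^ 2) * Real.exp (ε / 2 * y) *
          Real.exp (2 * Real.pi * y) := by ring
      _ ≤ Real.exp (ε * y) * Real.exp (2 * Real.pi * y) := by gcongr
      _ = _ := by rw [← Real.exp_add]; congr 1; ring
  obtain ⟨D, -, hD⟩ := exists_norm_le_exp_abs_im (s := 2 * Real.pi) hH
    ⟨1 + 2 * Real.pi, M * N * (2 / 1 ^ 2 + a ^ 2), fun z => by
      have hpi := Real.pi_pos
      calc _ ≤ _ := hHn z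
        _ ≤ M * N * ((2 / 1 ^ 2 + a ^ 2) * Real.exp (1 * ‖z‖) * Real.exp (2 * Real.pi * ‖z‖)) := by
            have h1 := sq_add_sq_le_mul_exp a (norm_nonneg z) one_pos
            have h2 := abs_im_le_norm z
            gcongr
        _ = _ := by
            rw [show (1 + 2 * Real.pi) * ‖z‖ = 1 * ‖z‖ + 2 * Real.pi * ‖z‖ by ring, Real.exp_add]
            ring⟩
    hint (by positivity) (hray I norm_I) (hray (-I) (by simp))
  have hpc := continuous_poissonPi ha
  rw [scalarProd, scalarProd, deBrangesMeasure_Ea ha, muA,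
    integral_withDensity_ofReal (Continuous.measurable (by fun_prop)) (fun x => by positivity),
    integral_withDensity_ofReal (Continuous.measurable (by fun_prop))
      (fun x => mul_nonneg (by positivity) (poissonPi_pos ha x).le)]
  simp only [mul_comm _ (poissonPi a _), mul_smul, ← hHreal]
  exact (integral_poissonPi_smul ha hH hD hint).symm

lemma eLpNorm_two_eq_of_scalarProd_eq {μ ν : Measure ℝ} {F : ℂ → ℂ}
    (hμ : MemLp (fun x : ℝ => F x) 2 μ) (hν : MemLp (fun x : ℝ => F x) 2 ν)
    (h : scalarProd μ F F = scalarProd ν F F) :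
    eLpNorm (fun x : ℝ => F x) 2 μ = eLpNorm (fun x : ℝ => F x) 2 ν := by
  have key : ∀ m : Measure ℝ, scalarProd m F F = ((∫ x : ℝ, ‖F x‖ ^ (2 : ℝ) ∂m : ℝ) : ℂ) := by
    intro m
    rw [scalarProd, ← integral_complex_ofReal]
    refine integral_congr_ae (Eventually.of_forall fun x => ?_)
    simp only [starFn, conj_ofReal]
    rw [mul_conj, normSq_eq_norm_sq, Real.rpow_two]
  rw [key, key, ofReal_inj] at h
  rw [hμ.eLpNorm_eq_integral_rpow_norm (by simp) (by simp),
    hν.eLpNorm_eq_integral_rpow_norm (by simp) (by simp)]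
  simp only [ENNReal.toReal_ofNat, h]

end DeBranges

theorem mainTheorem3 (a : ℝ) (ha : 0 < a) :
    DeBranges.IsHermiteBiehler (DeBranges.Ea a) ∧
    DeBranges.StandingConditions (DeBranges.Ea a) Real.pi ∧
    DeBranges.expTypeSpace 2 Real.pi (DeBranges.muA a) =
      DeBranges.deBrangesSpace (DeBranges.Ea a) ∧
    (∀ F ∈ DeBranges.deBrangesSpace (DeBranges.Ea a),
      ∀ G ∈ DeBranges.deBrangesSpace (DeBranges.Ea a),
        DeBranges.scalarProd (DeBranges.muA a) F G =
          DeBranges.scalarProd (DeBranges.deBrangesMeasure (DeBranges.Ea a)) F G) ∧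
    (∀ F ∈ DeBranges.deBrangesSpace (DeBranges.Ea a),
      MeasureTheory.eLpNorm (fun x : ℝ => F (x : ℂ)) 2 (DeBranges.muA a) =
        MeasureTheory.eLpNorm (fun x : ℝ => F (x : ℂ)) 2
          (DeBranges.deBrangesMeasure (DeBranges.Ea a))) := by
  have hsp := DeBranges.expTypeSpace_eq_deBrangesSpace ha
  refine ⟨DeBranges.isHermiteBiehler_Ea ha, DeBranges.standingConditions_Ea ha, hsp, ?_, ?_⟩
  · rw [← hsp]
    exact fun F hF G hG => DeBranges.scalarProd_eq ha hF hG
  · intro F hF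
    have hF' : F ∈ DeBranges.expTypeSpace 2 Real.pi (DeBranges.muA a) := hsp ▸ hF
    exact DeBranges.eLpNorm_two_eq_of_scalarProd_eq hF'.2 hF.2.1
      (DeBranges.scalarProd_eq ha hF' hF')
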